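/- Let $G$ be a finite group, $p$ a prime, $P\in\operatorname{Syl}_p(G)$ and $N=\mathbf N_G(P)$. Notation. $\operatorname{Irr}(H)$ is the set of irreducible complex characters of a finite group $H$, $\operatorname{Irr}_{p'}(H)$ the subset of those whose degree is not divisible by $p$, and $\operatorname{Irr}(B_0(H))$ the subset of those in the principal $p$-block of $H$. (As usual, blocks are defined with respect to a fixed maximal ideal $M$, with $p\in M$, of the ring of algebraic integers in $\mathbb C$: $\chi$ and $\psi$ lie in the same $p$-block if and only if $|K|\chi(g)/\chi(1)\equiv|K|\psi(g)/\psi(1)\pmod M$ for every conjugacy class $K$ and $g\in K$. The principal block contains the trivial character.) We write $\operatorname{Irr}_{p'}(B_0(H))=\operatorname{Irr}_{p'}(H)\cap\operatorname{Irr}(B_0(H))$. The conductor $c(\chi)$ is the smallest integer $n\ge1$ such that $\mathbb Q(\chi)\subseteq\mathbb Q_n$, where $\mathbb Q(\chi)$ is the field generated by the values of $\chi$ and $\mathbb Q_n$ is the $n$-th cyclotomic field, and $c(\chi)_p$ is the exact power of $p$ dividing $c(\chi)$. The character $\chi$ is called $p$-rational if $c(\chi)_p=1$, and almost $p$-rational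 if $c(\chi)_p\in\{1,p\}$. Finally, $\Phi(P)$ is the Frattini subgroup of $P$ and $\mathbf O_{p'}(H)$ the largest normal subgroup of $H$ of order prime to $p$. Suppose that there is a bijection ${}^*:\operatorname{Irr}_{p'}(G)\to\operatorname{Irr}_{p'}(N)$ such that for all $\chi\in\operatorname{Irr}_{p'}(G)$ we have 1. $c(\chi)_p=c(\chi^*)_p$, and 2. $\chi\in\operatorname{Irr}(B_0(G))$ if and only if $\chi^*\in\operatorname{Irr}(B_0(N))$. Set $K=N/\mathbf O_{p'}(N)\Phi(P)$ and let $Q\in\operatorname{Syl}_p(K)$ (then $Q$ is normal in $K$). Then the following are equivalent: (i) Every almost $p$-rational $\chi\in\operatorname{Irr}_{p'}(B_0(G))$ is $p$-rational. (ii) For every $1\ne y\in Q$: (a) $\mathbf N_K(\langle y\rangle)/\mathbf C_K(y)\cong\operatorname{Aut}(\langle y\rangle)$, and (b) $\mathbf N_K(\langle y\rangle)/Q$ acts trivially (by conjugation) on the set of conjugacy classes of $\mathbf C_K(y)/Q$. -/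

import Mathlib

namespace BlockTheory

/-! ### Irreducible complex characters -/

/-- `Irr(G)`: the set of irreducible complex characters of `G`, as functions `G → ℂ`. -/
def Irr (G : Type*) [Group G] : Set (G → ℂ) :=
  {χ | ∃ (n : ℕ) (ρ : Representation ℂ G (Fin n → ℂ)), ρ.IsIrreducible ∧ ρ.character = χ}

/-- `Irr_{p'}(G)`: the irreducible characters of `G` whose degree `χ(1)` is not divisible by `p`. -/
def IrrPrime (p : ℕ) (G : Type*) [Group G] : Set (G → ℂ) :=
  {χ | χ ∈ Irr G ∧ ∃ d : ℕ, χ 1 = (d : ℂ) ∧ ¬ p ∣ d}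

/-! ### Conductors and `p`-rationality -/

/-- The `n`-th cyclotomic field `ℚ_n` inside `ℂ`. -/
noncomputable def cyclotomic (n : ℕ) : IntermediateField ℚ ℂ :=
  IntermediateField.adjoin ℚ {ζ : ℂ | IsPrimitiveRoot ζ n}

/-- The field of values `ℚ(χ)`. -/
noncomputable def fieldOfValues {G : Type*} (χ : G → ℂ) : IntermediateField ℚ ℂ :=
  IntermediateField.adjoin ℚ (Set.range χ)

/-- The conductor `c(χ)`: the smallest positive `n` with `ℚ(χ) ⊆ ℚ_n`. For a character of a finite
group such an `n` exists (the order of the group is one). -/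
noncomputable def conductor {G : Type*} (χ : G → ℂ) : ℕ :=
  sInf {n : ℕ | 0 < n ∧ fieldOfValues χ ≤ cyclotomic n}

/-- The `p`-rationality level of `χ`: the exponent `α` with `c(χ)_p = p ^ α`. -/
noncomputable def pLevel (p : ℕ) {G : Type*} (χ : G → ℂ) : ℕ :=
  padicValNat p (conductor χ)

/-- The `p`-part `c(χ)_p` of the conductor. -/
noncomputable def conductorPPart (p : ℕ) {G : Type*} (χ : G → ℂ) : ℕ :=
  p ^ pLevel p χ

/-- `χ` is `p`-rational: its `p`-rationality level is `0`. -/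
def IsPRational (p : ℕ) {G : Type*} (χ : G → ℂ) : Prop :=
  pLevel p χ = 0

/-- `χ` is almost `p`-rational: its `p`-rationality level is at most `1`. -/
def IsAlmostPRational (p : ℕ) {G : Type*} (χ : G → ℂ) : Prop :=
  pLevel p χ ≤ 1

/-! ### The principal `p`-block

As usual, one fixes a maximal ideal `M` of the ring `R` of all algebraic integers in `ℂ` with
`p ∈ M`, and reduces central characters modulo `M`. -/

/-- The ring of all algebraic integers in `ℂ`. -/
abbrev AlgInt : Type := integralClosure ℤ ℂ

/-- The central character `ω_χ`, evaluated at the class sum of the conjugacy class `K` of `g`: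
`ω_χ(K̂) = |K| χ(g) / χ(1)`. -/
noncomputable def centralChar {G : Type*} [Group G] (χ : G → ℂ) (g : G) : ℂ :=
  (Nat.card (conjugatesOf g) : ℂ) * χ g / χ 1

/-- `χ` and `ψ` lie in the same block: `ω_χ(K̂)` and `ω_ψ(K̂)` are congruent modulo `M` for every
conjugacy class `K`. -/
def SameBlock (M : Ideal AlgInt) {G : Type*} [Group G] (χ ψ : G → ℂ) : Prop :=
  ∀ g : G, ∃ a : AlgInt, a ∈ M ∧ (a : ℂ) = centralChar χ g - centralChar ψ g

/-- `Irr(B_0(G))`: the irreducible characters in the block of the trivial character. -/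
def IrrPrincipalBlock (M : Ideal AlgInt) (G : Type*) [Group G] : Set (G → ℂ) :=
  {χ | χ ∈ Irr G ∧ SameBlock M χ 1}

/-! ### Subgroups and quotients -/

/-- `O_{p'}(H)`: the largest normal subgroup of `H` of order prime to `p`. -/
def primeCore (p : ℕ) (H : Type*) [Group H] : Subgroup H :=
  sSup {L : Subgroup H | L.Normal ∧ ¬ p ∣ Nat.card L}

instance primeCore_normal (p : ℕ) (H : Type*) [Group H] : (primeCore p H).Normal where
  conj_mem x hx g := by
    have h : primeCore p H ≤ (primeCore p H).comap (MulAut.conj g).toMonoidHom :=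
      sSup_le fun L hL y hy =>
        (le_sSup hL : L ≤ primeCore p H) (hL.1.conj_mem y hy g)
    exact h hx

/-- The Frattini subgroup `Φ(L)` of a subgroup `L ≤ H`, as a subgroup of `H`. -/
def frattiniOf {H : Type*} [Group H] (L : Subgroup H) : Subgroup H :=
  (frattini L).map L.subtype

instance frattiniOf_normal {H : Type*} [Group H] (L : Subgroup H) [L.Normal] :
    (frattiniOf L).Normal := by
  unfold frattiniOf
  infer_instance

section Local

variable {p : ℕ} {G : Type*} [Group G]

/-- The local subgroup `N_G(P)`. -/
abbrev normalizerSylow (P : Sylow p G) : Subgroup G :=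
  Subgroup.normalizer ((P : Subgroup G) : Set G)

/-- The subgroup `O_{p'}(N_G(P)) Φ(P)` of `N_G(P)`. -/
abbrev localKernel (P : Sylow p G) : Subgroup (normalizerSylow P) :=
  primeCore p (normalizerSylow P) ⊔
    frattiniOf ((P : Subgroup G).subgroupOf (normalizerSylow P))

/-- The group `K = N_G(P) / O_{p'}(N_G(P)) Φ(P)`. -/
abbrev LocalQuotient (P : Sylow p G) : Type _ :=
  normalizerSylow P ⧸ localKernel P

/-- A Sylow `p`-subgroup of `K` is normal in `K` (it is the image of `P`). -/
instance sylow_localQuotient_normal [Fact p.Prime] [Finite G] (P : Sylow p G)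
    (Q : Sylow p (LocalQuotient P)) : (Q : Subgroup (LocalQuotient P)).Normal := by
  have hs : Function.Surjective (QuotientGroup.mk' (localKernel P)) :=
    QuotientGroup.mk'_surjective _
  let P₁ : Sylow p (normalizerSylow P) := P.subtype Subgroup.le_normalizer
  have h₁ : (P₁ : Subgroup (normalizerSylow P)).Normal := by
    change ((P : Subgroup G).subgroupOf (normalizerSylow P)).Normal
    infer_instance
  have h₂ : (P₁.mapSurjective hs : Subgroup (LocalQuotient P)).Normal := by
    rw [Sylow.coe_mapSurjective]
    exact h₁.map _ hs
  have := (Sylow.unique_of_normal _ h₂).instSubsingleton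
  exact Sylow.normal_of_subsingleton Q

end Local

/-- `C_K(y)` is normal in `N_K(⟨y⟩)`. -/
instance centralizer_normal {K : Type*} [Group K] (y : K) :
    ((Subgroup.centralizer {y}).subgroupOf
      (Subgroup.normalizer (Subgroup.zpowers y : Set K))).Normal := by
  have h : Subgroup.centralizer ({y} : Set K) =
      Subgroup.centralizer (Subgroup.zpowers y : Set K) := by
    rw [Subgroup.zpowers_eq_closure, Subgroup.centralizer_closure]
  rw [h]
  infer_instance

/-- For subgroups `A`, `B` of a group, with `A` normalizing `B`: the conjugation action of `A` on the
set of conjugacy classes of `B` is trivial. -/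
def ActsTriviallyOnClasses {X : Type*} [Group X] (A B : Subgroup X) : Prop :=
  ∀ a ∈ A, ∀ b ∈ B, ∃ h ∈ B, h * b * h⁻¹ = a * b * a⁻¹

/-- `N_K(⟨y⟩) / C_K(y) ≅ Aut(⟨y⟩)`. -/
def FullAutomizer {K : Type*} [Group K] (y : K) : Prop :=
  Nonempty
    ((Subgroup.normalizer (Subgroup.zpowers y : Set K) ⧸
        (Subgroup.centralizer {y}).subgroupOf
          (Subgroup.normalizer (Subgroup.zpowers y : Set K))) ≃*
      MulAut (Subgroup.zpowers y))

/-- `N_K(⟨y⟩) / Q` acts trivially on the conjugacy classes of `C_K(y) / Q`, both regarded as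
subgroups of `K / Q`. -/
def TrivialOnCentralizerClasses {K : Type*} [Group K] (Q : Subgroup K) [Q.Normal] (y : K) : Prop :=
  ActsTriviallyOnClasses
    ((Subgroup.normalizer (Subgroup.zpowers y : Set K)).map (QuotientGroup.mk' Q))
    ((Subgroup.centralizer {y}).map (QuotientGroup.mk' Q))

/-! ### The two conjectural statements, for a given group and prime -/

/-- There is a bijection `Irr_{p'}(G) → Irr_{p'}(N_G(P))` which preserves the `p`-parts of conductors
and membership in the principal `p`-block. -/
def NavarroBijection (p : ℕ) (M : Ideal AlgInt) {G : Type*} [Group G] (P : Sylow p G) : Prop :=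
  ∃ e : IrrPrime p G ≃ IrrPrime p (normalizerSylow P),
    ∀ χ : IrrPrime p G,
      conductorPPart p (χ : G → ℂ) = conductorPPart p (e χ : normalizerSylow P → ℂ) ∧
      ((χ : G → ℂ) ∈ IrrPrincipalBlock M G ↔
        (e χ : normalizerSylow P → ℂ) ∈ IrrPrincipalBlock M (normalizerSylow P))

/-- Every almost `p`-rational character in `Irr_{p'}(B_0(G))` is `p`-rational. -/
def NoLevelOneInPrincipalBlock (p : ℕ) (M : Ideal AlgInt) (G : Type*) [Group G] : Prop :=
  ∀ χ : G → ℂ, χ ∈ IrrPrime p G → χ ∈ IrrPrincipalBlock M G →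
    IsAlmostPRational p χ → IsPRational p χ

end BlockTheory

open BlockTheory

namespace BlockTheory

open Module

/-! ### Cyclotomic fields -/

/-! The bijection preserves the `p`-part of the conductor and membership in the principal block, so
condition (i) for `G` is the same as condition (i) for `X = N_G(P)`. It remains to treat a group `X`
with a normal Sylow subgroup `P`. Let `m` be the `p'`-part of `|X|`, let `κ = O_{p'}(X)Φ(P)` and `K
= X/κ`.

The almost `p`-rational characters in `Irr_{p'}(B_0(X))` are exactly the inflations of the
irreducible characters of `K`. Characters of the principal block are trivial on `O_{p'}(X)`
(`apply_eq_one_of_sameBlock`), and an almost `p`-rational character of `p'`-degree is trivial on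
`Φ(P)` (`apply_eq_one_of_mem_frattiniOf`). Conversely, the Sylow subgroup `Q` of `K` is elementary
abelian, normal and complemented, so irreducible degrees of `K` are prime to `p`
(`finrank_dvd_card_of_isComplement'`). A `p'`-degree character trivial on `O_{p'}(X)` lies in the
principal block (`sameBlock_one_of_primeCore`), and it is almost `p`-rational because `K` has
exponent dividing `pm`.

Hence (i) says that every irreducible character of `K` is `p`-rational. Galois automorphisms act on
character values through power maps `g ↦ g ^ s`, and irreducible characters separate classes
(`isConj_of_forall_character_eq`). So (i) means that every `g` in `K` is conjugate to `g ^ s`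
whenever `s` is prime to `p` and `s ≡ 1` modulo `m`.

Write `g = yx` with commuting `y ∈ Q` and `x` of order dividing `m`. Then `g ^ s = y ^ s x`, so some
element must send `y` to `y ^ s` while centralizing `x`. For all `x` and `s` together this is (a)
and (b), because `p'`-elements congruent modulo `Q` are already `Q`-conjugate
(`forall_isConj_pow_iff`). -/

lemma mem_cyclotomic_of_pow_eq_one {n : ℕ} (hn : n ≠ 0) {z : ℂ} (hz : z ^ n = 1) :
    z ∈ cyclotomic n := by
  have : NeZero n := ⟨hn⟩
  have hζ := Complex.isPrimitiveRoot_exp n hn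
  obtain ⟨k, -, rfl⟩ := hζ.eq_pow_of_pow_eq_one hz
  have hmem : Complex.exp (2 * Real.pi * Complex.I / n) ∈ cyclotomic n :=
    IntermediateField.subset_adjoin ℚ _ hζ
  exact pow_mem hmem k

lemma cyclotomic_eq_adjoin_singleton {n : ℕ} (hn : n ≠ 0) :
    cyclotomic n = IntermediateField.adjoin ℚ {Complex.exp (2 * Real.pi * Complex.I / n)} := by
  have : NeZero n := ⟨hn⟩
  have hζ := Complex.isPrimitiveRoot_exp n hn
  apply le_antisymm
  · refine IntermediateField.adjoin_le_iff.2 fun z hz => ?_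
    obtain ⟨k, -, rfl⟩ := hζ.eq_pow_of_pow_eq_one (IsPrimitiveRoot.pow_eq_one hz)
    exact pow_mem (IntermediateField.mem_adjoin_simple_self ℚ _) k
  · exact IntermediateField.adjoin_le_iff.2
      (Set.singleton_subset_iff.2 (IntermediateField.subset_adjoin ℚ _ hζ))

lemma pow_eq_one_of_dvd_of_pow_eq_one {R : Type*} [Monoid R] {z : R} {a b : ℕ} (h : a ∣ b)
    (hz : z ^ a = 1) : z ^ b = 1 := by
  obtain ⟨c, rfl⟩ := h
  rw [pow_mul, hz, one_pow]

lemma modEq_of_isPrimitiveRoot_pow_eq {ζ : ℂ} {n s t : ℕ} (hn : n ≠ 0) (hζ : IsPrimitiveRoot ζ n)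
    (h : ζ ^ s = ζ ^ t) : s ≡ t [MOD n] := by
  have : IsOfFinOrder ζ := isOfFinOrder_iff_pow_eq_one.2 ⟨n, Nat.pos_of_ne_zero hn, hζ.pow_eq_one⟩
  rwa [hζ.eq_orderOf, ← this.pow_eq_pow_iff_modEq]

instance isCyclotomicExtension_cyclotomic (n : ℕ) [NeZero n] :
    IsCyclotomicExtension {n} ℚ (cyclotomic n) :=
  (IntermediateField.isCyclotomicExtension_singleton_iff_eq_adjoin n ℚ ℂ (cyclotomic n)
    (Complex.isPrimitiveRoot_exp n (NeZero.ne n))).2 (cyclotomic_eq_adjoin_singleton (NeZero.ne n))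

lemma cyclotomic_mono {a b : ℕ} (hb : b ≠ 0) (h : a ∣ b) : cyclotomic a ≤ cyclotomic b := by
  refine IntermediateField.adjoin_le_iff.2 fun z hz => mem_cyclotomic_of_pow_eq_one hb ?_
  obtain ⟨c, rfl⟩ := h
  rw [pow_mul, IsPrimitiveRoot.pow_eq_one hz, one_pow]

instance finiteDimensional_cyclotomic (n : ℕ) [NeZero n] :
    FiniteDimensional ℚ (cyclotomic n) :=
  IsCyclotomicExtension.finiteDimensional {n} ℚ (cyclotomic n)

instance isGalois_cyclotomic (n : ℕ) [NeZero n] : IsGalois ℚ (cyclotomic n) :=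
  IsCyclotomicExtension.isGalois {n} ℚ (cyclotomic n)

instance numberField_cyclotomic (n : ℕ) [NeZero n] : NumberField (cyclotomic n) :=
  IsCyclotomicExtension.numberField {n} ℚ (cyclotomic n)

/-- The automorphism of `ℚ_n` raising the `n`-th roots of unity to the power `s`. -/
lemma exists_cyclotomic_aut (n : ℕ) [NeZero n] {s : ℕ} (hs : s.Coprime n) :
    ∃ σ : Gal(cyclotomic n/ℚ), ∀ z : cyclotomic n, z ^ n = 1 → σ z = z ^ s := by
  refine ⟨(IsCyclotomicExtension.Rat.galEquivZMod n (cyclotomic n)).symm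
    (ZMod.unitOfCoprime s hs), fun z hz => ?_⟩
  rw [IsCyclotomicExtension.Rat.galEquivZMod_apply_of_pow_eq n _ _ hz, MulEquiv.apply_symm_apply,
    ZMod.coe_unitOfCoprime, ZMod.val_natCast]
  conv_rhs => rw [← Nat.mod_add_div s n, pow_add, pow_mul, hz, one_pow, mul_one]

/-- Every automorphism of `ℚ_n` raises the `n`-th roots of unity to a power prime to `n`. -/
lemma cyclotomic_aut_eq_pow (n : ℕ) [NeZero n] (σ : Gal(cyclotomic n/ℚ)) :
    ∃ s : ℕ, s.Coprime n ∧ ∀ z : cyclotomic n, z ^ n = 1 → σ z = z ^ s :=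
  ⟨_, ZMod.val_coe_unit_coprime _, fun _ hz =>
    IsCyclotomicExtension.Rat.galEquivZMod_apply_of_pow_eq n _ σ hz⟩

/-- Two homomorphisms which agree on the `a`-th roots of unity agree on `ℚ_a`. -/
lemma algHom_eq_of_mem_cyclotomic {n a : ℕ} [NeZero n] (ha : a ∣ n)
    (σ τ : Gal(cyclotomic n/ℚ))
    (h : ∀ z : cyclotomic n, z ^ a = 1 → σ z = τ z)
    (x : cyclotomic n) (hx : (x : ℂ) ∈ cyclotomic a) : σ x = τ x := by
  let F : IntermediateField ℚ (cyclotomic n) :=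
    AlgHom.equalizer (σ : cyclotomic n →ₐ[ℚ] cyclotomic n) (τ : _ →ₐ[ℚ] _) |>.toIntermediateField
      (fun y hy => by
        simp only [AlgHom.mem_equalizer] at hy ⊢
        rw [map_inv₀, map_inv₀, hy])
  have hle : cyclotomic a ≤ IntermediateField.lift F := by
    refine IntermediateField.adjoin_le_iff.2 fun z hz => ?_
    have hza : z ^ a = 1 := IsPrimitiveRoot.pow_eq_one hz
    have hzn : z ∈ cyclotomic n :=
      cyclotomic_mono (NeZero.ne n) ha (IntermediateField.subset_adjoin ℚ _ hz)
    have : (⟨z, hzn⟩ : cyclotomic n) ∈ F := h _ (Subtype.ext (by simpa using hza))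
    exact (IntermediateField.mem_lift (⟨z, hzn⟩ : cyclotomic n)).2 this
  exact (IntermediateField.mem_lift x).1 (hle hx)

/-- Galois descent to a cyclotomic subfield. -/
lemma mem_cyclotomic_of_fixed {n a : ℕ} [NeZero n] (ha : a ∣ n) (x : cyclotomic n)
    (h : ∀ σ : Gal(cyclotomic n/ℚ), (∀ z : cyclotomic n, z ^ a = 1 → σ z = z) → σ x = x) :
    (x : ℂ) ∈ cyclotomic a := by
  have hle := cyclotomic_mono (NeZero.ne n) ha
  have ha0 : a ≠ 0 := fun h0 => NeZero.ne n (by simpa [h0] using ha)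
  have key : x ∈ IntermediateField.fixedField
      (IntermediateField.fixingSubgroup (IntermediateField.restrict hle)) := by
    rw [IntermediateField.mem_fixedField_iff]
    intro σ hσ
    refine h σ fun z hz => ?_
    rw [IntermediateField.mem_fixingSubgroup_iff] at hσ
    refine hσ z ((IntermediateField.mem_restrict hle z).2 (mem_cyclotomic_of_pow_eq_one ha0 ?_))
    have := congrArg (Subtype.val) hz
    simpa using this
  have hG : @IsGalois ℚ _ (cyclotomic n) _ (IntermediateField.algebra' _) := isGalois_cyclotomic n
  rw [IsGalois.fixedField_fixingSubgroup] at key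
  exact (IntermediateField.mem_restrict hle x).1 key

/-- By Galois descent, only automorphisms trivial on the `gcd`-th roots of unity matter. The Chinese
remainder theorem for non-coprime moduli replaces such an automorphism by one that agrees with it on
`ℚ_b` and is trivial on `ℚ_a`. This is what makes the conductor, defined as a minimum, behave as a
least divisor. -/
lemma cyclotomic_inf_le {a b : ℕ} (ha : a ≠ 0) (hb : b ≠ 0) :
    cyclotomic a ⊓ cyclotomic b ≤ cyclotomic (a.gcd b) := by
  rintro x ⟨hxa, hxb⟩
  have hab : NeZero (a * b) := ⟨mul_ne_zero ha hb⟩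
  have hdva : a ∣ a * b := dvd_mul_right a b
  have hdvb : b ∣ a * b := dvd_mul_left b a
  have hdvg : a.gcd b ∣ a * b := (Nat.gcd_dvd_left a b).trans hdva
  lift x to cyclotomic (a * b) using cyclotomic_mono (NeZero.ne _) hdva hxa
  refine mem_cyclotomic_of_fixed hdvg x fun σ hσ => ?_
  obtain ⟨s, hs, hσs⟩ := cyclotomic_aut_eq_pow (a * b) σ
  have hg0 : a.gcd b ≠ 0 := Nat.gcd_ne_zero_left ha
  have hs1 : 1 ≡ s [MOD a.gcd b] := by
    have hζ := Complex.isPrimitiveRoot_exp (a.gcd b) hg0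
    set ζ := Complex.exp (2 * Real.pi * Complex.I / (a.gcd b : ℕ))
    have hmem : ζ ∈ cyclotomic (a * b) :=
      cyclotomic_mono (NeZero.ne _) hdvg (mem_cyclotomic_of_pow_eq_one hg0 hζ.pow_eq_one)
    have h1 : (⟨ζ, hmem⟩ : cyclotomic (a * b)) ^ (a.gcd b) = 1 :=
      Subtype.ext (by simpa using hζ.pow_eq_one)
    have h2 : (⟨ζ, hmem⟩ : cyclotomic (a * b)) ^ (a * b) = 1 :=
      pow_eq_one_of_dvd_of_pow_eq_one hdvg h1
    have h3 := (hσ _ h1).symm.trans (hσs _ h2)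
    have h4 : ζ ^ 1 = ζ ^ s := by simpa using congrArg Subtype.val h3
    exact modEq_of_isPrimitiveRoot_pow_eq hg0 hζ h4
  obtain ⟨t, ht1, hts⟩ := Nat.chineseRemainder' hs1
  have htc : t.Coprime (a * b) := by
    refine Nat.Coprime.mul_right ?_ ?_
    · rw [Nat.Coprime, ht1.gcd_eq, Nat.gcd_one_left]
    · rw [Nat.Coprime, hts.gcd_eq]
      exact hs.coprime_dvd_right hdvb
  obtain ⟨τ, hτ⟩ := exists_cyclotomic_aut (a * b) htc
  have e1 : σ x = τ x := algHom_eq_of_mem_cyclotomic hdvb σ τ (fun z hz => by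
    have hz' := pow_eq_one_of_dvd_of_pow_eq_one hdvb hz
    rw [hσs z hz', hτ z hz', pow_eq_pow_of_modEq hts hz]) x hxb
  have e2 : τ x = (1 : Gal(cyclotomic (a * b)/ℚ)) x := algHom_eq_of_mem_cyclotomic hdva τ 1
    (fun z hz => by
      rw [hτ z (pow_eq_one_of_dvd_of_pow_eq_one hdva hz), pow_eq_pow_of_modEq ht1 hz, pow_one]
      rfl) x hxa
  rw [e1, e2]; rfl

lemma fieldOfValues_le_iff {G : Type*} (χ : G → ℂ) (n : ℕ) :
    fieldOfValues χ ≤ cyclotomic n ↔ ∀ g, χ g ∈ cyclotomic n := by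
  rw [fieldOfValues, IntermediateField.adjoin_le_iff]
  exact Set.range_subset_iff

/-- The conductor divides `n` exactly when `ℚ_n` contains all values. -/
lemma conductor_dvd_iff {G : Type*} {χ : G → ℂ} {N : ℕ} (hN : N ≠ 0)
    (hχ : ∀ g, χ g ∈ cyclotomic N) {n : ℕ} (hn : n ≠ 0) :
    conductor χ ∣ n ↔ ∀ g, χ g ∈ cyclotomic n := by
  have hne : {n : ℕ | 0 < n ∧ fieldOfValues χ ≤ cyclotomic n}.Nonempty :=
    ⟨N, Nat.pos_of_ne_zero hN, (fieldOfValues_le_iff χ N).2 hχ⟩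
  obtain ⟨hpos, hle⟩ : 0 < conductor χ ∧ fieldOfValues χ ≤ cyclotomic (conductor χ) :=
    Nat.sInf_mem hne
  rw [← fieldOfValues_le_iff]
  constructor
  · exact fun h => hle.trans (cyclotomic_mono hn h)
  · intro h
    have h1 : fieldOfValues χ ≤ cyclotomic ((conductor χ).gcd n) :=
      (le_inf hle h).trans (cyclotomic_inf_le hpos.ne' hn)
    have h2 : conductor χ ≤ (conductor χ).gcd n :=
      Nat.sInf_le ⟨Nat.gcd_pos_of_pos_left _ hpos, h1⟩
    have h3 : (conductor χ).gcd n = conductor χ :=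
      le_antisymm (Nat.le_of_dvd hpos (Nat.gcd_dvd_left _ _)) h2
    exact h3 ▸ Nat.gcd_dvd_right _ _

/-! ### Traces of powers -/

/-- The traces of the powers of an operator of finite order, in terms of its eigenvalues. -/
lemma exists_trace_pow_eq_sum {V : Type*} [AddCommGroup V] [Module ℂ V] [FiniteDimensional ℂ V]
    (f : End ℂ V) {n : ℕ} (hn : n ≠ 0) (hf : f ^ n = 1) :
    ∃ (s : Finset ℂ) (d : ℂ → ℕ), (∀ μ ∈ s, μ ^ n = 1) ∧
      ∀ k : ℕ, LinearMap.trace ℂ V (f ^ k) = ∑ μ ∈ s, d μ * μ ^ k := by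
  classical
  -- `X ^ n - 1` is separable over `ℂ`, so `f` is diagonalizable and traces can be computed on
  -- eigenspaces.
  have hss : f.IsSemisimple := by
    refine Module.End.isSemisimple_of_squarefree_aeval_eq_zero
      (p := (Polynomial.X ^ n - 1 : Polynomial ℂ)) ?_ (by simp [hf])
    exact (Polynomial.X_pow_sub_one_separable_iff.2 (by exact_mod_cast hn)).squarefree
  have htop := hss.iSup_eigenspace_eq_top
  have hint : DirectSum.IsInternal f.eigenspace :=
    (DirectSum.isInternal_submodule_iff_iSupIndep_and_iSup_eq_top _).2
      ⟨f.eigenspaces_iSupIndep, htop⟩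
  have hfin : {μ | f.eigenspace μ ≠ ⊥}.Finite :=
    WellFoundedGT.finite_ne_bot_of_iSupIndep f.eigenspaces_iSupIndep
  have hpow : ∀ (k : ℕ) (μ : ℂ) (v : V), v ∈ f.eigenspace μ → (f ^ k) v = μ ^ k • v := by
    intro k μ v hv
    rw [Module.End.mem_eigenspace_iff] at hv
    induction k with
    | zero => simp
    | succ k ih => rw [pow_succ, Module.End.mul_apply, hv, map_smul, ih, smul_smul, pow_succ, mul_comm]
  refine ⟨hfin.toFinset, fun μ => finrank ℂ (f.eigenspace μ), fun μ hμ => ?_, fun k => ?_⟩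
  · have h1 : f.eigenspace μ ≠ ⊥ := by simpa using hμ
    obtain ⟨v, hv, hv0⟩ := (Submodule.ne_bot_iff _).1 h1
    have h2 := hpow n μ v hv
    rw [hf, Module.End.one_apply] at h2
    have h3 : (μ ^ n - 1) • v = 0 := by rw [sub_smul, one_smul, ← h2, sub_self]
    exact sub_eq_zero.1 ((smul_eq_zero.1 h3).resolve_right hv0)
  · have hmaps : ∀ μ, Set.MapsTo (f ^ k) (f.eigenspace μ) (f.eigenspace μ) := fun μ v hv => by
      rw [hpow k μ v hv]
      exact Submodule.smul_mem _ _ hv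
    rw [LinearMap.trace_eq_sum_trace_restrict' hint hfin hmaps]
    refine Finset.sum_congr rfl fun μ _ => ?_
    have : (f ^ k).restrict (hmaps μ) = μ ^ k • LinearMap.id := by
      ext v
      exact hpow k μ v v.2
    rw [this, map_smul, LinearMap.trace_id, smul_eq_mul, mul_comm]

/-! ### Galois action on character values and the `p`-part of the conductor -/

section Character

variable {G V : Type*} [Group G] [Finite G] [AddCommGroup V] [Module ℂ V] [FiniteDimensional ℂ V]
  (ρ : Representation ℂ G V)

lemma exists_character_pow_eq_sum (g : G) :
    ∃ (s : Finset ℂ) (d : ℂ → ℕ), (∀ μ ∈ s, μ ^ orderOf g = 1) ∧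
      ∀ k : ℕ, ρ.character (g ^ k) = ∑ μ ∈ s, d μ * μ ^ k := by
  obtain ⟨s, d, h1, h2⟩ := exists_trace_pow_eq_sum (ρ g) (orderOf_pos g).ne'
    (by rw [← map_pow, pow_orderOf_eq_one, map_one])
  exact ⟨s, d, h1, fun k => by rw [← h2, ← map_pow]; rfl⟩

lemma character_mem_cyclotomic (g : G) : ρ.character g ∈ cyclotomic (Nat.card G) := by
  obtain ⟨s, d, h1, h2⟩ := exists_character_pow_eq_sum ρ g
  have := h2 1
  rw [pow_one] at this
  rw [this]
  refine sum_mem fun μ hμ => mul_mem (natCast_mem _ _) (pow_mem ?_ _)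
  refine mem_cyclotomic_of_pow_eq_one Nat.card_pos.ne' ?_
  obtain ⟨c, hc⟩ := orderOf_dvd_natCard g
  rw [hc, pow_mul, h1 μ hμ, one_pow]

lemma isIntegral_character (g : G) : IsIntegral ℤ (ρ.character g) := by
  obtain ⟨s, d, h1, h2⟩ := exists_character_pow_eq_sum ρ g
  have := h2 1
  rw [pow_one] at this
  rw [this]
  refine IsIntegral.sum _ fun μ hμ => IsIntegral.mul (isIntegral_algebraMap (x := (d μ : ℤ)))
    (IsIntegral.pow ?_ _)
  exact IsIntegral.of_pow (orderOf_pos g) (by rw [h1 μ hμ]; exact isIntegral_one)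

/-- The eigenvalues of `ρ g` are roots of unity; raising each to the power `s` gives the eigenvalues
of `ρ (g ^ s)`, with the same multiplicities. Rationality questions thereby become questions about
power maps. -/
lemma galois_character {s : ℕ} [NeZero (Nat.card G)] (σ : Gal(cyclotomic (Nat.card G)/ℚ))
    (hσ : ∀ z : cyclotomic (Nat.card G), z ^ Nat.card G = 1 → σ z = z ^ s) (g : G) :
    (σ ⟨ρ.character g, character_mem_cyclotomic ρ g⟩ : ℂ) = ρ.character (g ^ s) := by
  obtain ⟨S, d, h1, h2⟩ := exists_character_pow_eq_sum ρ g
  have h1' : ∀ μ ∈ S, μ ^ Nat.card G = 1 := fun μ hμ => by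
    obtain ⟨c, hc⟩ := orderOf_dvd_natCard g
    rw [hc, pow_mul, h1 μ hμ, one_pow]
  have hmem : ∀ μ ∈ S, μ ∈ cyclotomic (Nat.card G) := fun μ hμ =>
    mem_cyclotomic_of_pow_eq_one (NeZero.ne _) (h1' μ hμ)
  have e : (⟨ρ.character g, character_mem_cyclotomic ρ g⟩ : cyclotomic (Nat.card G)) =
      ∑ μ : S, (d μ : cyclotomic (Nat.card G)) * ⟨μ, hmem μ μ.2⟩ := by
    apply Subtype.ext
    have h3 := h2 1
    rw [pow_one, ← Finset.sum_coe_sort] at h3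
    refine h3.trans ?_
    push_cast
    simp
  rw [e, map_sum, h2 s, ← Finset.sum_coe_sort S, AddSubmonoidClass.coe_finsetSum]
  refine Finset.sum_congr rfl fun μ _ => ?_
  rw [map_mul, map_natCast, hσ _ (Subtype.ext (by simpa using h1' μ μ.2))]
  simp

/-- The values of a character lie in `ℚ_n` exactly when they are invariant under the power maps
which are trivial on the `n`-th roots of unity. -/
lemma character_mem_cyclotomic_iff {n : ℕ} (hn : n ∣ Nat.card G) :
    (∀ g, ρ.character g ∈ cyclotomic n) ↔
      ∀ s : ℕ, s.Coprime (Nat.card G) → s ≡ 1 [MOD n] →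
        ∀ g, ρ.character (g ^ s) = ρ.character g := by
  have : NeZero (Nat.card G) := ⟨Nat.card_pos.ne'⟩
  have hpow : ∀ z : cyclotomic (Nat.card G), z ^ n = 1 → z ^ Nat.card G = 1 :=
    fun _ hz => pow_eq_one_of_dvd_of_pow_eq_one hn hz
  constructor
  · intro h s hs hs1 g
    obtain ⟨σ, hσ⟩ := exists_cyclotomic_aut (Nat.card G) hs
    rw [← galois_character ρ σ hσ g]
    refine congrArg Subtype.val (algHom_eq_of_mem_cyclotomic hn σ 1 (fun z hz => ?_)
      ⟨ρ.character g, character_mem_cyclotomic ρ g⟩ (h g))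
    rw [hσ z (hpow z hz), AlgEquiv.one_apply, pow_eq_pow_of_modEq hs1 hz, pow_one]
  · intro h g
    refine mem_cyclotomic_of_fixed hn ⟨ρ.character g, character_mem_cyclotomic ρ g⟩ fun σ hσ => ?_
    obtain ⟨s, hs, hσs⟩ := cyclotomic_aut_eq_pow (Nat.card G) σ
    have hn0 : n ≠ 0 := fun h0 => NeZero.ne (Nat.card G) (by simpa [h0] using hn)
    have hs1 : s ≡ 1 [MOD n] := by
      have hζ := Complex.isPrimitiveRoot_exp n hn0
      set ζ := Complex.exp (2 * Real.pi * Complex.I / n)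
      have hmem : ζ ∈ cyclotomic (Nat.card G) :=
        cyclotomic_mono (NeZero.ne _) hn (mem_cyclotomic_of_pow_eq_one hn0 hζ.pow_eq_one)
      have h1 : (⟨ζ, hmem⟩ : cyclotomic (Nat.card G)) ^ n = 1 :=
        Subtype.ext (by simpa using hζ.pow_eq_one)
      have h4 : ζ ^ s = ζ ^ 1 := by
        simpa using congrArg Subtype.val ((hσs _ (hpow _ h1)).symm.trans (hσ _ h1))
      exact modEq_of_isPrimitiveRoot_pow_eq hn0 hζ h4
    apply Subtype.ext
    rw [galois_character ρ σ hσs g]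
    exact h s hs hs1 g

lemma conductor_character_dvd_iff {n : ℕ} (hn : n ∣ Nat.card G) :
    conductor ρ.character ∣ n ↔
      ∀ s : ℕ, s.Coprime (Nat.card G) → s ≡ 1 [MOD n] →
        ∀ g, ρ.character (g ^ s) = ρ.character g := by
  rw [← character_mem_cyclotomic_iff ρ hn]
  exact conductor_dvd_iff Nat.card_pos.ne' (character_mem_cyclotomic ρ)
    (fun h0 => Nat.card_pos.ne' (by simpa [h0] using hn))

lemma conductor_character_dvd_card : conductor ρ.character ∣ Nat.card G :=
  (conductor_dvd_iff Nat.card_pos.ne' (character_mem_cyclotomic ρ) Nat.card_pos.ne').2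
    (character_mem_cyclotomic ρ)

variable (p : ℕ) [hp : Fact p.Prime]

/-- A character is `p`-rational exactly when it is invariant under the power maps with exponent
congruent to one modulo the `p'`-part of the group order. -/
lemma isPRational_character_iff :
    IsPRational p ρ.character ↔
      ∀ s : ℕ, s.Coprime (Nat.card G) → s ≡ 1 [MOD ordCompl[p] (Nat.card G)] →
        ∀ g, ρ.character (g ^ s) = ρ.character g := by
  rw [← conductor_character_dvd_iff ρ (Nat.ordCompl_dvd _ p), IsPRational, pLevel]
  have hc := conductor_character_dvd_card ρ
  have hN : Nat.card G ≠ 0 := Nat.card_pos.ne'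
  have hc0 : conductor ρ.character ≠ 0 := fun h0 => hN (by simpa [h0] using hc)
  constructor
  · intro h
    have h1 : ¬ p ∣ conductor ρ.character := fun hd =>
      absurd (one_le_padicValNat_of_dvd hc0 hd) (by rw [h]; decide)
    have h2 : (conductor ρ.character).Coprime (p ^ (Nat.card G).factorization p) :=
      ((Nat.Prime.coprime_iff_not_dvd hp.out).2 h1).symm.pow_right _
    refine h2.dvd_of_dvd_mul_left ?_
    rwa [Nat.ordProj_mul_ordCompl_eq_self]
  · intro h
    exact padicValNat.eq_zero_of_not_dvd fun hd =>
      Nat.not_dvd_ordCompl hp.out hN (hd.trans h)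

/-- An almost `p`-rational character is invariant under the power maps with exponent congruent to
one modulo `p` times the `p'`-part of the group order. -/
lemma IsAlmostPRational.character_pow (h : IsAlmostPRational p ρ.character) {s : ℕ}
    (hs : s.Coprime (Nat.card G)) (hs1 : s ≡ 1 [MOD p * ordCompl[p] (Nat.card G)]) (g : G) :
    ρ.character (g ^ s) = ρ.character g := by
  have hc := conductor_character_dvd_card ρ
  have hN : Nat.card G ≠ 0 := Nat.card_pos.ne'
  have hc0 : conductor ρ.character ≠ 0 := fun h0 => hN (by simpa [h0] using hc)
  refine (conductor_character_dvd_iff ρ hc).1 dvd_rfl s hs (hs1.of_dvd ?_) g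
  rw [← Nat.ordProj_mul_ordCompl_eq_self (conductor ρ.character) p]
  refine mul_dvd_mul ?_ ?_
  · have : (conductor ρ.character).factorization p ≤ 1 := by
      rw [Nat.factorization_def _ hp.out]; exact h
    simpa using pow_dvd_pow p this
  · exact Nat.ordCompl_dvd_ordCompl_of_dvd hc p

lemma isAlmostPRational_of_character_pow
    (h : ∀ s : ℕ, s.Coprime (Nat.card G) → s ≡ 1 [MOD p * ordCompl[p] (Nat.card G)] →
      ∀ g, ρ.character (g ^ s) = ρ.character g) : IsAlmostPRational p ρ.character := by
  have hN : Nat.card G ≠ 0 := Nat.card_pos.ne'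
  rw [IsAlmostPRational, pLevel]
  by_cases hpG : p ∣ Nat.card G
  · have hd : p * ordCompl[p] (Nat.card G) ∣ Nat.card G := by
      conv_rhs => rw [← Nat.ordProj_mul_ordCompl_eq_self (Nat.card G) p]
      refine mul_dvd_mul_right (dvd_pow_self p ?_) _
      exact (hp.out.factorization_pos_of_dvd hN hpG).ne'
    have h1 := (conductor_character_dvd_iff ρ hd).2 h
    by_contra h2
    have h3 : p ^ 2 ∣ conductor ρ.character :=
      (pow_dvd_pow p (by omega)).trans pow_padicValNat_dvd
    have h4 := h3.trans h1
    rw [pow_two] at h4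
    exact Nat.not_dvd_ordCompl hp.out hN (Nat.dvd_of_mul_dvd_mul_left hp.out.pos h4)
  -- Here `p` times the `p'`-part no longer divides the group order, so the criterion is
  -- unavailable; but the conductor divides the order and is itself prime to `p`.
  · rw [padicValNat.eq_zero_of_not_dvd fun hd => hpG (hd.trans (conductor_character_dvd_card ρ))]
    exact zero_le_one

end Character

/-! ### Irreducible representations -/

section General

variable {G V : Type*} [Group G] [AddCommGroup V] [Module ℂ V] {ρ : Representation ℂ G V}

lemma eq_bot_or_eq_top_of_invariant [ρ.IsIrreducible] (W : Submodule ℂ V)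
    (hW : ∀ g, ∀ v ∈ W, ρ g v ∈ W) : W = ⊥ ∨ W = ⊤ := by
  rcases eq_bot_or_eq_top (⟨W, fun g v hv => hW g v hv⟩ : Subrepresentation ρ) with h | h
  · exact Or.inl (congrArg Subrepresentation.toSubmodule h)
  · exact Or.inr (congrArg Subrepresentation.toSubmodule h)

lemma nontrivial_of_isIrreducible (ρ : Representation ℂ G V) [ρ.IsIrreducible] : Nontrivial V := by
  by_contra h
  rw [not_nontrivial_iff_subsingleton] at h
  refine bot_ne_top (α := Subrepresentation ρ) (Subrepresentation.toSubmodule_injective ?_)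
  exact Subsingleton.elim _ _

lemma isIrreducible_of_invariant [Nontrivial V]
    (h : ∀ W : Submodule ℂ V, (∀ g, ∀ v ∈ W, ρ g v ∈ W) → W = ⊥ ∨ W = ⊤) : ρ.IsIrreducible where
  exists_pair_ne := ⟨⊥, ⊤, fun e => bot_ne_top (α := Submodule ℂ V)
    (congrArg Subrepresentation.toSubmodule e)⟩
  eq_bot_or_eq_top W := (h W.toSubmodule fun g _ hv => W.apply_mem_toSubmodule g hv).imp
    (fun e => Subrepresentation.toSubmodule_injective e)
    (fun e => Subrepresentation.toSubmodule_injective e)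

lemma isIrreducible_comp {H : Type*} [Group H] (f : H →* G) (hf : Function.Surjective f)
    [ρ.IsIrreducible] : Representation.IsIrreducible (ρ.comp f : Representation ℂ H V) := by
  have := nontrivial_of_isIrreducible ρ
  refine isIrreducible_of_invariant fun W hW => eq_bot_or_eq_top_of_invariant (ρ := ρ) W ?_
  intro g v hv
  obtain ⟨h, rfl⟩ := hf g
  exact hW h v hv

/-- A subrepresentation with no proper nonzero subrepresentation is irreducible. -/
lemma isIrreducible_toRepresentation (S : Subrepresentation ρ) (hS : S ≠ ⊥)
    (h : ∀ T : Subrepresentation ρ, T ≤ S → T = ⊥ ∨ T = S) :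
    S.toRepresentation.IsIrreducible := by
  have hS' : S.toSubmodule ≠ ⊥ := fun e => hS (Subrepresentation.toSubmodule_injective e)
  have : Nontrivial S.toSubmodule := Submodule.nontrivial_iff_ne_bot.2 hS'
  refine isIrreducible_of_invariant fun W hW => ?_
  let T : Subrepresentation ρ :=
    { toSubmodule := W.map S.toSubmodule.subtype
      apply_mem_toSubmodule := by
        rintro g _ ⟨w, hw, rfl⟩
        exact ⟨_, hW g w hw, rfl⟩ }
  have hTS : T ≤ S := Submodule.map_subtype_le S.toSubmodule W
  rcases h T hTS with e | e
  · left
    have e' : W.map S.toSubmodule.subtype = ⊥ := congrArg Subrepresentation.toSubmodule e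
    exact (Submodule.map_injective_of_injective S.toSubmodule.injective_subtype)
      (e'.trans (Submodule.map_bot _).symm)
  · right
    have e' : W.map S.toSubmodule.subtype = S.toSubmodule :=
      congrArg Subrepresentation.toSubmodule e
    apply Submodule.map_injective_of_injective S.toSubmodule.injective_subtype
    rw [e', Submodule.map_subtype_top]

variable [FiniteDimensional ℂ V]

/-- Serves two minimality arguments: for nonzero subrepresentations, and for those of dimension
prime to `p`. -/
lemma exists_minimal_subrepresentation (C : Subrepresentation ρ → Prop)
    (h : ∃ W, C W) : ∃ S, C S ∧ ∀ T, C T → T ≤ S → T = S := by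
  obtain ⟨S, hS, hmin⟩ := (InvImage.wf (fun W : Subrepresentation ρ => finrank ℂ W.toSubmodule)
    wellFounded_lt).has_min {W | C W} h
  refine ⟨S, hS, fun T hT hTS => Subrepresentation.toSubmodule_injective ?_⟩
  exact Submodule.eq_of_le_of_finrank_le hTS (not_lt.1 (hmin T hT))

lemma exists_irreducible_le (W : Subrepresentation ρ) (hW : W ≠ ⊥) :
    ∃ S ≤ W, S.toRepresentation.IsIrreducible := by
  obtain ⟨S, ⟨hS, hSW⟩, hmin⟩ := exists_minimal_subrepresentation
    (fun S : Subrepresentation ρ => S ≠ ⊥ ∧ S ≤ W) ⟨W, hW, le_rfl⟩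
  refine ⟨S, hSW, isIrreducible_toRepresentation S hS fun T hT => ?_⟩
  by_cases h : T = ⊥
  · exact Or.inl h
  · exact Or.inr (hmin T ⟨h, hT.trans hSW⟩ hT)

/-- Schur's lemma. -/
lemma exists_eq_smul_one [ρ.IsIrreducible] (f : End ℂ V) (hf : ∀ g, ρ g * f = f * ρ g) :
    ∃ c : ℂ, f = c • 1 := by
  have := nontrivial_of_isIrreducible ρ
  obtain ⟨c, hc⟩ := Module.End.exists_eigenvalue f
  refine ⟨c, ?_⟩
  have hinv : ∀ g, ∀ v ∈ f.eigenspace c, ρ g v ∈ f.eigenspace c := by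
    intro g v hv
    rw [Module.End.mem_eigenspace_iff] at hv ⊢
    have := LinearMap.congr_fun (hf g) v
    simp only [Module.End.mul_apply] at this
    rw [← this, hv, map_smul]
  rcases eq_bot_or_eq_top_of_invariant (ρ := ρ) (f.eigenspace c) hinv with h | h
  · exact absurd h hc
  · ext v
    have : v ∈ f.eigenspace c := h ▸ Submodule.mem_top
    simpa using Module.End.mem_eigenspace_iff.1 this

/-- Schur's lemma, with the scalar computed by the trace. -/
lemma eq_trace_div_finrank_smul_one [ρ.IsIrreducible] (f : End ℂ V)
    (hf : ∀ g, ρ g * f = f * ρ g) : f = (LinearMap.trace ℂ V f / finrank ℂ V) • 1 := by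
  have := nontrivial_of_isIrreducible ρ
  obtain ⟨c, rfl⟩ := exists_eq_smul_one (ρ := ρ) f hf
  have : (finrank ℂ V : ℂ) ≠ 0 := Nat.cast_ne_zero.2 finrank_pos.ne'
  simp [LinearMap.trace_one, this]

/-- `Irr` only admits representations on the spaces `Fin n → ℂ`, so a representation on an arbitrary
space is transported along a basis. -/
lemma character_mem_Irr [ρ.IsIrreducible] : ρ.character ∈ Irr G := by
  have := nontrivial_of_isIrreducible ρ
  let e : V ≃ₗ[ℂ] (Fin (finrank ℂ V) → ℂ) := (finBasis ℂ V).equivFun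
  let σ : Representation ℂ G (Fin (finrank ℂ V) → ℂ) :=
    { toFun := fun g => e.conj (ρ g)
      map_one' := by rw [map_one]; exact e.conj_id
      map_mul' := fun g h => by rw [map_mul]; exact LinearEquiv.conj_comp e _ _ }
  have hσ : ∀ g v, σ g (e v) = e (ρ g v) := fun g v => by
    change e.conj (ρ g) (e v) = _
    simp [LinearEquiv.conj_apply]
  refine ⟨finrank ℂ V, σ, ?_, ?_⟩
  · have : Nontrivial (Fin (finrank ℂ V) → ℂ) := e.symm.toEquiv.nontrivial
    refine isIrreducible_of_invariant fun W hW => ?_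
    have hinv : ∀ g, ∀ v ∈ W.comap e.toLinearMap, ρ g v ∈ W.comap e.toLinearMap := by
      intro g v hv
      have := hW g (e v) hv
      rw [hσ] at this
      exact this
    rcases eq_bot_or_eq_top_of_invariant (ρ := ρ) (W.comap e.toLinearMap) hinv with h | h
    · left
      rw [eq_bot_iff]
      intro w hw
      have : e.symm w ∈ W.comap e.toLinearMap := by simpa using hw
      rw [h, Submodule.mem_bot] at this
      simpa using this
    · right
      rw [eq_top_iff]
      intro w _
      have : e.symm w ∈ W.comap e.toLinearMap := h ▸ Submodule.mem_top
      simpa using this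
  · funext g
    exact LinearMap.trace_conj' (ρ g) e

omit [FiniteDimensional ℂ V] in
/-- If a normal subgroup fixes a nonzero vector of an irreducible representation, then it acts
trivially. -/
lemma apply_eq_one_of_fixed [ρ.IsIrreducible] (L : Subgroup G) [hL : L.Normal] {v : V} (hv : v ≠ 0)
    (h : ∀ x ∈ L, ρ x v = v) {x : G} (hx : x ∈ L) : ρ x = 1 := by
  let W : Submodule ℂ V := ⨅ x : L, LinearMap.eqLocus (ρ x) LinearMap.id
  have hmem : ∀ w, w ∈ W ↔ ∀ x ∈ L, ρ x w = w := fun w => by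
    simp [W, Submodule.mem_iInf, LinearMap.mem_eqLocus]
  have hinv : ∀ g, ∀ w ∈ W, ρ g w ∈ W := by
    intro g w hw
    rw [hmem] at hw ⊢
    intro x hx
    have h1 := hw _ (hL.conj_mem x hx g⁻¹)
    rw [← Module.End.mul_apply, ← map_mul, show x * g = g * (g⁻¹ * x * g⁻¹⁻¹) by group, map_mul,
      Module.End.mul_apply, h1]
  rcases eq_bot_or_eq_top_of_invariant (ρ := ρ) W hinv with hW | hW
  · exact absurd ((Submodule.mem_bot ℂ).1 (hW ▸ (hmem v).2 h)) hv
  · ext w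
    exact (hmem w).1 (hW ▸ Submodule.mem_top) x hx

omit [FiniteDimensional ℂ V] in
lemma character_mul_right_of_apply_eq_one {x : G} (hx : ρ x = 1) (g : G) :
    ρ.character (g * x) = ρ.character g := by
  rw [Representation.character, map_mul, hx, mul_one, Representation.character]

end General

/-! ### Characters separate conjugacy classes -/

section Separation

variable {G : Type*} [Group G] [Finite G]

/-- The irreducible characters separate the conjugacy classes. -/
theorem isConj_of_forall_character_eq {a b : G} (h : ∀ χ ∈ Irr G, χ a = χ b) : IsConj a b := by
  classical
  cases nonempty_fintype G
  -- The difference of the two class averages is central. On an irreducible constituent it is a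
  -- scalar of trace zero, hence zero; complete reducibility then kills it on every representation.
  have key : ∀ {V : Type _} [AddCommGroup V] [Module ℂ V] [FiniteDimensional ℂ V]
      (ρ : Representation ℂ G V), ∑ k, (ρ (k * a * k⁻¹) - ρ (k * b * k⁻¹)) = 0 := by
    intro V _ _ _ ρ
    have hcomm : ∀ {U : Type _} [AddCommGroup U] [Module ℂ U] (σ : Representation ℂ G U) (g : G),
        σ g * ∑ k, (σ (k * a * k⁻¹) - σ (k * b * k⁻¹)) =
          (∑ k, (σ (k * a * k⁻¹) - σ (k * b * k⁻¹))) * σ g := by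
      intro U _ _ σ g
      rw [Finset.mul_sum, Finset.sum_mul]
      refine Fintype.sum_equiv (Equiv.mulLeft g) _ _ fun k => ?_
      rw [mul_sub, sub_mul, ← map_mul, ← map_mul, ← map_mul, ← map_mul, Equiv.coe_mulLeft]
      rw [show g * (k * a * k⁻¹) = g * k * a * (g * k)⁻¹ * g by group,
        show g * (k * b * k⁻¹) = g * k * b * (g * k)⁻¹ * g by group]
    set Z := ∑ k, (ρ (k * a * k⁻¹) - ρ (k * b * k⁻¹)) with hZ
    let W : Subrepresentation ρ :=
      { toSubmodule := LinearMap.ker Z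
        apply_mem_toSubmodule := fun g v hv => by
          rw [LinearMap.mem_ker] at hv ⊢
          rw [← Module.End.mul_apply, ← hcomm ρ g, Module.End.mul_apply, hv, map_zero] }
    obtain ⟨W', hW'⟩ := exists_isCompl W
    by_cases hb : W' = ⊥
    · have hT : W = ⊤ := by simpa [hb] using hW'.sup_eq_top
      exact LinearMap.ker_eq_top.1 (congrArg Subrepresentation.toSubmodule hT)
    · exfalso
      obtain ⟨S, hSW, hS⟩ := exists_irreducible_le W' hb
      have hZS := eq_trace_div_finrank_smul_one (ρ := S.toRepresentation) _ (hcomm S.toRepresentation)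
      have htr : LinearMap.trace ℂ S.toSubmodule (∑ k, (S.toRepresentation (k * a * k⁻¹) -
          S.toRepresentation (k * b * k⁻¹))) = 0 := by
        rw [map_sum]
        refine Finset.sum_eq_zero fun k _ => ?_
        rw [map_sub]
        change S.toRepresentation.character _ - S.toRepresentation.character _ = 0
        rw [Representation.char_conj, Representation.char_conj, h _ character_mem_Irr, sub_self]
      rw [htr, zero_div, zero_smul] at hZS
      have hle : S ≤ W := fun v hv => by
        change Z v = 0
        have h2 := congrArg Subtype.val (LinearMap.congr_fun hZS ⟨v, hv⟩)
        rw [hZ, LinearMap.sum_apply]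
        rw [LinearMap.sum_apply, AddSubmonoidClass.coe_finsetSum] at h2
        exact h2
      have hbot : S = ⊥ := le_bot_iff.1 (hW'.disjoint hle hSW)
      have hnt := nontrivial_of_isIrreducible S.toRepresentation
      rw [Submodule.nontrivial_iff_ne_bot] at hnt
      exact hnt (congrArg Subrepresentation.toSubmodule hbot)
  by_contra hab
  -- In the regular representation, evaluating at `a` the image of the delta function at `1` counts
  -- the `k` with `k * a * k⁻¹ = a`, minus the `k` with `k * b * k⁻¹ = a`. The first count includes
  -- `k = 1`; the second is zero if `a` and `b` are not conjugate.
  let R : Representation ℂ G (G → ℂ) :=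
    { toFun := fun g => LinearMap.funLeft ℂ ℂ (fun x => g⁻¹ * x)
      map_one' := by ext f x; simp [LinearMap.funLeft_apply]
      map_mul' := fun g h => by ext f x; simp [LinearMap.funLeft_apply, mul_assoc] }
  have hR : ∀ g, R g (Pi.single 1 1) a = if g = a then 1 else 0 := fun g => by
    change (Pi.single 1 1 : G → ℂ) (g⁻¹ * a) = _
    rw [Pi.single_apply]
    simp only [inv_mul_eq_one]
  have h1 := congrFun (LinearMap.congr_fun (key R) (Pi.single 1 1)) a
  have hb : ∀ k, k * b * k⁻¹ ≠ a := fun k hk => hab ((isConj_iff.2 ⟨k, hk⟩).symm)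
  simp only [LinearMap.sum_apply, LinearMap.sub_apply, Finset.sum_apply, Pi.sub_apply, hR, hb,
    if_false, sub_zero, Finset.sum_boole, LinearMap.zero_apply, Pi.zero_apply, Nat.cast_eq_zero,
    Finset.card_eq_zero, Finset.filter_eq_empty_iff] at h1
  exact h1 (Finset.mem_univ 1) (by group)

end Separation

/-! ### Integrality -/

section Integrality

variable {V : Type*} [AddCommGroup V] [Module ℂ V]

/-- An eigenvalue of a matrix of algebraic integers is an algebraic integer. -/
lemma isIntegral_of_smul_eq_sum {ι : Type*} [Finite ι] {c : ℂ} {s : ι → Finset ι} {v : ι → V}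
    {F : ι → ι → ℂ} (hF : ∀ i j, IsIntegral ℤ (F i j)) (h : ∀ i, c • v i = ∑ j ∈ s i, F i j • v j)
    {i : ι} (hi : v i ≠ 0) : IsIntegral ℤ c := by
  let N : Submodule AlgInt V := Submodule.span AlgInt (Set.range v)
  have hmem : ∀ i, v i ∈ N := fun i => Submodule.subset_span ⟨i, rfl⟩
  have hc : IsIntegral AlgInt c := by
    refine isIntegral_of_smul_mem_submodule N (fun e => hi ?_)
      (Submodule.fg_span (Set.finite_range v)) c fun n hn => ?_
    · exact (Submodule.mem_bot AlgInt).1 (e ▸ hmem i)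
    · induction hn using Submodule.span_induction with
      | mem x hx =>
        obtain ⟨i, rfl⟩ := hx
        rw [h]
        exact Submodule.sum_mem _ fun j _ =>
          N.smul_mem (⟨F i j, hF i j⟩ : AlgInt) (hmem j)
      | zero => simp
      | add x y _ _ hx hy => rw [smul_add]; exact N.add_mem hx hy
      | smul a x _ hx => rw [smul_comm]; exact N.smul_mem a hx
  exact isIntegral_trans c hc

variable [FiniteDimensional ℂ V]

/-- Each eigenvalue is zero or a root of unity. The relation `f ^ (n + 1) = f` is the one satisfied
by a finite-order operator times a commuting projection. -/
lemma isIntegral_trace_of_pow_succ_eq (f : End ℂ V) {n : ℕ} (hn : 0 < n) (hf : f ^ (n + 1) = f) :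
    IsIntegral ℤ (LinearMap.trace ℂ V f) := by
  rw [Module.End.trace_eq_sum_roots_charpoly_of_splits (IsAlgClosed.splits _)]
  refine IsIntegral.multiset_sum fun μ hμ => ?_
  rw [Polynomial.mem_roots f.charpoly_monic.ne_zero, ← Module.End.hasEigenvalue_iff_isRoot_charpoly]
    at hμ
  obtain ⟨v, hv⟩ := hμ.exists_hasEigenvector
  have h1 := hv.pow_apply (n + 1)
  rw [hf, hv.apply_eq_smul] at h1
  have h2 : μ ^ (n + 1) = μ := (smul_left_injective ℂ hv.2 h1).symm
  by_cases h0 : μ = 0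
  · rw [h0]; exact isIntegral_zero
  · refine IsIntegral.of_pow hn ?_
    rw [pow_succ] at h2
    rw [mul_eq_right₀ h0 |>.1 h2]
    exact isIntegral_one

lemma dvd_of_isIntegral_div {a b : ℕ} (hb : b ≠ 0) (h : IsIntegral ℤ ((a : ℂ) / b)) : b ∣ a := by
  have h1 : IsIntegral ℤ ((a : ℚ) / b) := by
    rw [← isIntegral_algebraMap_iff (algebraMap ℚ ℂ).injective]
    simpa using h
  obtain ⟨z, hz⟩ := IsIntegrallyClosed.isIntegral_iff.1 h1
  have hb' : (b : ℚ) ≠ 0 := Nat.cast_ne_zero.2 hb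
  rw [eq_div_iff hb'] at hz
  have h2 : z * b = a := by
    rw [eq_intCast] at hz
    exact_mod_cast hz
  exact Int.natCast_dvd_natCast.1 ⟨z, by rw [← h2, mul_comm]⟩

end Integrality

/-! ### Projections onto the isotypic components of linear characters -/

section Isotypic

variable {Q V : Type*} [Group Q] [AddCommGroup V] [Module ℂ V]

lemma monoidHom_mul_inv (lam : Q →* ℂ) (q : Q) : lam q * lam q⁻¹ = 1 := by
  rw [← map_mul, mul_inv_cancel, map_one]

lemma monoidHom_ne_zero (lam : Q →* ℂ) (q : Q) : lam q ≠ 0 :=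
  left_ne_zero_of_mul_eq_one (monoidHom_mul_inv lam q)

variable [Finite Q]

/-- The projection onto the `lam`-isotypic component. -/
noncomputable def isotypicProj (ρ : Representation ℂ Q V) (lam : Q →* ℂ) : End ℂ V :=
  letI := Fintype.ofFinite Q
  (Nat.card Q : ℂ)⁻¹ • ∑ q, lam q⁻¹ • ρ q

variable (ρ : Representation ℂ Q V) (lam : Q →* ℂ)

lemma apply_mul_isotypicProj (q : Q) : ρ q * isotypicProj ρ lam = lam q • isotypicProj ρ lam := by
  let := Fintype.ofFinite Q
  rw [isotypicProj, mul_smul_comm, smul_comm (lam q), Finset.mul_sum]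
  congr 1
  rw [Finset.smul_sum]
  refine Fintype.sum_equiv (Equiv.mulLeft q) _ _ fun x => ?_
  rw [mul_smul_comm, ← map_mul, smul_smul, Equiv.coe_mulLeft, mul_comm (lam q), ← map_mul]
  congr 2
  group

lemma isotypicProj_mul_apply (q : Q) : isotypicProj ρ lam * ρ q = lam q • isotypicProj ρ lam := by
  let := Fintype.ofFinite Q
  rw [isotypicProj, smul_mul_assoc, smul_comm (lam q), Finset.sum_mul]
  congr 1
  rw [Finset.smul_sum]
  refine Fintype.sum_equiv (Equiv.mulRight q) _ _ fun x => ?_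
  rw [smul_mul_assoc, ← map_mul, smul_smul, Equiv.coe_mulRight, ← map_mul]
  congr 2
  group

variable {ρ lam} in
lemma isotypicProj_apply_of_eigenvector {v : V} (hv : ∀ q, ρ q v = lam q • v) :
    isotypicProj ρ lam v = v := by
  let := Fintype.ofFinite Q
  have h : ∀ q : Q, (lam q⁻¹ • ρ q) v = v := fun q => by
    rw [LinearMap.smul_apply, hv, smul_smul, mul_comm, monoidHom_mul_inv, one_smul]
  have hQ : (Nat.card Q : ℂ) ≠ 0 := Nat.cast_ne_zero.2 Nat.card_pos.ne'
  rw [isotypicProj, LinearMap.smul_apply, LinearMap.sum_apply, Finset.sum_congr rfl fun q _ => h q,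
    Finset.sum_const, Finset.card_univ, ← Nat.card_eq_fintype_card, ← Nat.cast_smul_eq_nsmul ℂ,
    smul_smul, inv_mul_cancel₀ hQ, one_smul]

lemma isotypicProj_mul_self : isotypicProj ρ lam * isotypicProj ρ lam = isotypicProj ρ lam := by
  ext v
  exact isotypicProj_apply_of_eigenvector fun q =>
    LinearMap.congr_fun (apply_mul_isotypicProj ρ lam q) v

lemma trace_isotypicProj [FiniteDimensional ℂ V] [Fintype Q] :
    LinearMap.trace ℂ V (isotypicProj ρ lam) =
      (Nat.card Q : ℂ)⁻¹ * ∑ q, lam q⁻¹ * ρ.character q := by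
  rw [isotypicProj, map_smul, map_sum, smul_eq_mul]
  congr 1
  refine Finset.sum_congr (by congr!) fun q _ => ?_
  rw [map_smul, smul_eq_mul, Representation.character]

lemma trace_isotypicProj_ne_zero [FiniteDimensional ℂ V] {v : V} (hv0 : v ≠ 0)
    (hv : ∀ q, ρ q v = lam q • v) : LinearMap.trace ℂ V (isotypicProj ρ lam) ≠ 0 := by
  intro h
  have h1 := LinearMap.IsIdempotentElem.eq_zero_of_trace_eq_zero (isotypicProj_mul_self ρ lam) h
  have h2 := isotypicProj_apply_of_eigenvector hv
  rw [h1] at h2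
  exact hv0 h2.symm

end Isotypic

/-- A one-dimensional subrepresentation gives a linear character. -/
lemma exists_linear_of_finrank_eq_one {Q V : Type*} [Group Q] [AddCommGroup V]
    [Module ℂ V] {ρ : Representation ℂ Q V} (S : Subrepresentation ρ)
    (hS : finrank ℂ S.toSubmodule = 1) :
    ∃ (lam : Q →* ℂ) (v : V), v ≠ 0 ∧ ∀ q, ρ q v = lam q • v := by
  obtain ⟨v, hv0, hv⟩ := finrank_eq_one_iff'.1 hS
  choose c hc using fun q => hv (S.toRepresentation q v)
  have hv0' : (v : V) ≠ 0 := fun h => hv0 (Subtype.ext h)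
  have hc' : ∀ q, ρ q v = c q • (v : V) := fun q => (congrArg Subtype.val (hc q)).symm
  refine ⟨⟨⟨c, ?_⟩, fun q r => ?_⟩, v, hv0', hc'⟩
  · refine smul_left_injective ℂ hv0' ?_
    simp only
    rw [← hc', map_one, one_smul, Module.End.one_apply]
  · refine smul_left_injective ℂ hv0' ?_
    simp only
    rw [← hc', map_mul, Module.End.mul_apply, hc', map_smul, hc', smul_smul, mul_comm]

lemma exists_linear_of_comm {Q V : Type*} [Group Q] [AddCommGroup V]
    [Module ℂ V] [FiniteDimensional ℂ V] [Nontrivial V] [IsMulCommutative Q]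
    (ρ : Representation ℂ Q V) :
    ∃ (lam : Q →* ℂ) (v : V), v ≠ 0 ∧ ∀ q, ρ q v = lam q • v := by
  obtain ⟨S, -, hS⟩ := exists_irreducible_le (⊤ : Subrepresentation ρ)
    (fun e => bot_ne_top (α := Submodule ℂ V) (congrArg Subrepresentation.toSubmodule e).symm)
  exact exists_linear_of_finrank_eq_one S
    (Representation.IsIrreducible.finrank_eq_one_of_isMulCommutative S.toRepresentation)

/-! ### Degrees of irreducible representations -/

section Degree

variable {K V : Type*} [Group K] [Finite K] [AddCommGroup V] [Module ℂ V] [FiniteDimensional ℂ V]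

/-- If `Q` is an abelian normal subgroup with a complement `H`, then the degrees of the irreducible
representations divide the order of `H`. -/
theorem finrank_dvd_card_of_isComplement' (ρ : Representation ℂ K V) [ρ.IsIrreducible]
    {Q H : Subgroup K} [hQ : Q.Normal] [IsMulCommutative Q] (hc : Q.IsComplement' H) :
    finrank ℂ V ∣ Nat.card H := by
  have hnt := nontrivial_of_isIrreducible ρ
  have := Fintype.ofFinite H
  let ρQ : Representation ℂ Q V := ρ.comp Q.subtype
  obtain ⟨lam, v, hv0, hv⟩ := exists_linear_of_comm ρQ
  set π := isotypicProj ρQ lam with hπ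
  have hππ : π * π = π := isotypicProj_mul_self ρQ lam
  have hπv : π v = v := isotypicProj_apply_of_eigenvector hv
  have hl : ∀ q : Q, ρ q * π = lam q • π := apply_mul_isotypicProj ρQ lam
  have hr : ∀ q : Q, π * ρ q = lam q • π := isotypicProj_mul_apply ρQ lam
  let cj : K → Q → Q := fun h q => ⟨h⁻¹ * q * h, by simpa using hQ.conj_mem q q.2 h⁻¹⟩
  have hcj : ∀ (h : K) (q : Q), ρ q * ρ h = ρ h * ρ (cj h q) := fun h q => by
    rw [← map_mul, ← map_mul]
    congr 1
    simp only [cj]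
    group
  have hcj' : ∀ (h : K) (q : Q), ρ h⁻¹ * ρ q = ρ (cj h q) * ρ h⁻¹ := fun h q => by
    rw [← map_mul, ← map_mul]
    congr 1
    simp only [cj]
    group
  have hlh : ∀ (h : K) (q : Q), ρ q * (ρ h * π) = lam (cj h q) • (ρ h * π) := fun h q => by
    rw [← mul_assoc, hcj, mul_assoc, hl, mul_smul_comm]
  -- the dichotomy: either `h` commutes with the projection, or the compression of `h` vanishes
  have hdich : ∀ h, π * ρ h * π = 0 ∨ π * ρ h = ρ h * π := by
    intro h
    by_cases hst : ∀ q, lam (cj h q) = lam q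
    · right
      have h1 : π * (ρ h * π) = ρ h * π := by
        ext w
        exact isotypicProj_apply_of_eigenvector fun q => by
          have := LinearMap.congr_fun (hlh h q) w
          rw [hst] at this
          exact this
      have h2 : (π * ρ h) * π = π * ρ h := by
        let := Fintype.ofFinite Q
        have h3 : ∀ q : Q, (π * ρ h) * ρ q = lam q • (π * ρ h) := fun q => by
          obtain ⟨r, rfl⟩ : ∃ r, cj h r = q :=
            ⟨⟨h * q * h⁻¹, hQ.conj_mem q q.2 h⟩, Subtype.ext (by simp only [cj]; group)⟩
          rw [mul_assoc, ← hcj, ← mul_assoc, hr, smul_mul_assoc, hst]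
        have h4 : ∀ q : Q, (π * ρ h) * (lam q⁻¹ • ρQ q) = π * ρ h := fun q => by
          rw [mul_smul_comm]
          change lam q⁻¹ • ((π * ρ h) * ρ q) = _
          rw [h3, smul_smul, mul_comm, monoidHom_mul_inv, one_smul]
        have hQ0 : (Nat.card Q : ℂ) ≠ 0 := Nat.cast_ne_zero.2 Nat.card_pos.ne'
        have h5 : π = (Nat.card Q : ℂ)⁻¹ • ∑ q, lam q⁻¹ • ρQ q := rfl
        conv_lhs => rw [show (π * ρ h) * π = (π * ρ h) *
          ((Nat.card Q : ℂ)⁻¹ • ∑ q, lam q⁻¹ • ρQ q) from congrArg (π * ρ h * ·) h5]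
        rw [mul_smul_comm, Finset.mul_sum, Finset.sum_congr rfl fun q _ => h4 q,
          Finset.sum_const, Finset.card_univ, ← Nat.card_eq_fintype_card,
          ← Nat.cast_smul_eq_nsmul ℂ, smul_smul, inv_mul_cancel₀ hQ0, one_smul]
      rw [← h2, mul_assoc, h1]
    · left
      push Not at hst
      obtain ⟨q, hq⟩ := hst
      have h1 : lam q • (π * ρ h * π) = lam (cj h q) • (π * ρ h * π) := by
        rw [← smul_mul_assoc, ← smul_mul_assoc, ← hr, mul_assoc, mul_assoc, hlh, mul_smul_comm,
          mul_assoc]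
      rw [← sub_eq_zero, ← sub_smul] at h1
      exact (smul_eq_zero.1 h1).resolve_left (sub_ne_zero.2 hq.symm)
  -- averaging over the complement
  have havg : ∀ A : End ℂ V, ∑ h : H, ρ h * (π * A * π) * ρ (h : K)⁻¹ =
      ((Nat.card H : ℂ) / finrank ℂ V * LinearMap.trace ℂ V (A * π)) • 1 := by
    intro A
    have hcomm : ∀ g, ρ g * (∑ h : H, ρ h * (π * A * π) * ρ (h : K)⁻¹) =
        (∑ h : H, ρ h * (π * A * π) * ρ (h : K)⁻¹) * ρ g := by
      have hcQ : ∀ q : Q, ρ q * (∑ h : H, ρ h * (π * A * π) * ρ (h : K)⁻¹) =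
          (∑ h : H, ρ h * (π * A * π) * ρ (h : K)⁻¹) * ρ q := by
        intro q
        rw [Finset.mul_sum, Finset.sum_mul]
        refine Finset.sum_congr rfl fun h _ => ?_
        have e1 : ρ q * (ρ h * (π * A * π) * ρ (h : K)⁻¹) =
            (ρ q * (ρ h * π)) * (A * π * ρ (h : K)⁻¹) := by simp only [mul_assoc]
        have e2 : ρ h * (π * A * π) * ρ (h : K)⁻¹ * ρ q =
            (ρ h * π * A) * (π * (ρ (h : K)⁻¹ * ρ q)) := by simp only [mul_assoc]
        rw [e1, e2, hlh, hcj', ← mul_assoc π, hr]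
        simp only [smul_mul_assoc, mul_smul_comm, mul_assoc]
      have hcH : ∀ k : H, ρ k * (∑ h : H, ρ h * (π * A * π) * ρ (h : K)⁻¹) =
          (∑ h : H, ρ h * (π * A * π) * ρ (h : K)⁻¹) * ρ k := by
        intro k
        rw [Finset.mul_sum, Finset.sum_mul]
        refine Fintype.sum_equiv (Equiv.mulLeft k) _ _ fun h => ?_
        rw [Equiv.coe_mulLeft, Subgroup.coe_mul, mul_assoc (ρ ((k : K) * h) * (π * A * π)),
          ← map_mul, show ((k : K) * h)⁻¹ * k = (h : K)⁻¹ by group, map_mul]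
        simp only [mul_assoc]
      intro g
      obtain ⟨⟨q, k⟩, rfl⟩ := hc.surjective g
      simp only [map_mul]
      rw [mul_assoc, hcH, ← mul_assoc, hcQ, mul_assoc]
    have htr : LinearMap.trace ℂ V (∑ h : H, ρ h * (π * A * π) * ρ (h : K)⁻¹) =
        Nat.card H * LinearMap.trace ℂ V (A * π) := by
      rw [map_sum]
      have : ∀ h : H, LinearMap.trace ℂ V (ρ h * (π * A * π) * ρ (h : K)⁻¹) =
          LinearMap.trace ℂ V (A * π) := fun h => by
        rw [LinearMap.trace_mul_comm, ← mul_assoc, ← map_mul, inv_mul_cancel, map_one, one_mul,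
          mul_assoc, LinearMap.trace_mul_comm, mul_assoc, hππ]
      rw [Finset.sum_congr rfl fun h _ => this h, Finset.sum_const, Finset.card_univ,
        ← Nat.card_eq_fintype_card, nsmul_eq_mul]
    rw [eq_trace_div_finrank_smul_one (ρ := ρ) _ hcomm, htr]
    congr 1
    ring
  set c : ℂ := (Nat.card H : ℂ) / finrank ℂ V
  let f : K → ℂ := fun h => LinearMap.trace ℂ V (π * ρ h * π)
  -- A Schur orthogonality relation: take for `A` the rank-one operators sending `w` to `b.coord i w
  -- • v`, evaluate at `b i` and sum over `i`, which assembles the trace `f`.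
  have horth : ∑ h : H, f (h : K)⁻¹ • (π * ρ h * π) v = c • v := by
    let b := finBasis ℂ V
    have hi : ∀ i, ∑ h : H, (b.coord i ((π * ρ (h : K)⁻¹ * π) (b i))) • (π * ρ h * π) v =
        (c * b.coord i v) • π (b i) := by
      intro i
      have h1 := congrArg (fun T : End ℂ V => (π * T * π) (b i))
        (havg ((b.coord i).smulRight v))
      have h2 : LinearMap.trace ℂ V ((b.coord i).smulRight v * π) = b.coord i v := by
        rw [LinearMap.trace_mul_comm]
        have : π * (b.coord i).smulRight v = (b.coord i).smulRight v := by
          ext w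
          simp [hπv]
        rw [this, LinearMap.trace_smulRight]
      rw [h2] at h1
      simp only [Finset.mul_sum, Finset.sum_mul, mul_smul_comm, smul_mul_assoc, mul_one, hππ,
        LinearMap.smul_apply, LinearMap.sum_apply] at h1
      rw [← h1]
      refine Finset.sum_congr rfl fun h _ => ?_
      simp [Module.End.mul_apply, hπv]
    have hf : ∀ h, f h = ∑ i, b.coord i ((π * ρ h * π) (b i)) := fun h => by
      simp only [f]
      rw [LinearMap.trace_eq_matrix_trace ℂ b, Matrix.trace]
      simp [LinearMap.toMatrix_apply]
    calc ∑ h : H, f (h : K)⁻¹ • (π * ρ h * π) v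
        = ∑ i, ∑ h : H, (b.coord i ((π * ρ (h : K)⁻¹ * π) (b i))) • (π * ρ h * π) v := by
          rw [Finset.sum_comm]
          refine Finset.sum_congr rfl fun h _ => ?_
          rw [hf, Finset.sum_smul]
      _ = ∑ i, (c * b.coord i v) • π (b i) := Finset.sum_congr rfl fun i _ => hi i
      _ = c • π (∑ i, b.coord i v • b i) := by
          rw [map_sum, Finset.smul_sum]
          refine Finset.sum_congr rfl fun i _ => ?_
          rw [map_smul, smul_smul]
      _ = c • v := by
          have : ∑ i, b.coord i v • b i = v := b.sum_repr v
          rw [this, hπv]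
  have hfint : ∀ h, IsIntegral ℤ (f h) := by
    intro h
    rcases hdich h with h0 | h0
    · simp only [f, h0, map_zero]
      exact isIntegral_zero
    · have hcom : Commute (ρ h) π := h0.symm
      have : π * ρ h * π = ρ h * π := by rw [h0, mul_assoc, hππ]
      simp only [f, this]
      refine isIntegral_trace_of_pow_succ_eq _ (orderOf_pos h) ?_
      have hid : π ^ (orderOf h + 1) = π := (show IsIdempotentElem π from hππ).pow_succ_eq _
      rw [hcom.mul_pow, hid, pow_succ, ← map_pow, pow_orderOf_eq_one, map_one, one_mul]
  refine dvd_of_isIntegral_div finrank_pos.ne' ?_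
  -- The vectors `π ρ(t) π v` satisfy a linear system with eigenvalue `c = |H| / dim V` and
  -- algebraic integer coefficients `f (h⁻¹ t)`. The vector at `t = 1` is `v ≠ 0`, so `c` is an
  -- algebraic integer, hence an integer.
  refine isIntegral_of_smul_eq_sum (ι := H) (s := fun _ => Finset.univ)
    (v := fun t => (π * ρ t * π) v) (F := fun t h => f ((h : K)⁻¹ * t)) (i := 1)
    (fun _ _ => hfint _) (fun t => ?_) (by simpa [hπv] using hv0)
  have hstep : ∀ h : H, f (h : K)⁻¹ • (π * ρ t * π) ((π * ρ h * π) v) =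
      f (h : K)⁻¹ • (π * ρ ((t * h : H) : K) * π) v := by
    intro h
    rcases hdich (h : K)⁻¹ with h0 | h0
    · simp only [f, h0, map_zero, zero_smul]
    · congr 1
      have h1 : π * ρ h = ρ h * π := by
        have e1 : ρ h * ρ (h : K)⁻¹ = 1 := by rw [← map_mul, mul_inv_cancel, map_one]
        have e2 : ρ (h : K)⁻¹ * ρ h = 1 := by rw [← map_mul, inv_mul_cancel, map_one]
        calc π * ρ h = ρ h * (ρ (h : K)⁻¹ * π) * ρ h := by rw [← mul_assoc, e1, one_mul]
          _ = ρ h * (π * ρ (h : K)⁻¹) * ρ h := by rw [h0]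
          _ = ρ h * π := by rw [mul_assoc, mul_assoc, e2, mul_one]
      rw [← Module.End.mul_apply]
      congr 1
      rw [Subgroup.coe_mul, map_mul, h1]
      calc π * ρ t * π * (ρ h * π * π) = π * ρ t * (π * ρ h) * (π * π) := by
            simp only [mul_assoc]
        _ = π * ρ t * (ρ h * π) * π := by rw [h1, hππ]
        _ = π * ρ t * ρ h * (π * π) := by simp only [mul_assoc]
        _ = π * (ρ t * ρ h) * π := by rw [hππ]; simp only [mul_assoc]
  calc c • (π * ρ t * π) v = (π * ρ t * π) (c • v) := (map_smul _ _ _).symm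
    _ = ∑ h : H, f (h : K)⁻¹ • (π * ρ ((t * h : H) : K) * π) v := by
      rw [← horth, map_sum]
      refine Finset.sum_congr rfl fun h _ => ?_
      rw [map_smul, hstep]
    _ = ∑ h : H, f ((h : K)⁻¹ * t) • (π * ρ h * π) v := by
      refine Fintype.sum_equiv (Equiv.mulLeft t) _ _ fun h => ?_
      have : f (h : K)⁻¹ = f (((t * h : H) : K)⁻¹ * t) := by
        congr 1
        rw [Subgroup.coe_mul]
        group
      rw [Equiv.coe_mulLeft, ← this]

/-- The case where the abelian normal subgroup is trivial and its complement is the whole group. -/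
theorem finrank_dvd_card (ρ : Representation ℂ K V) [ρ.IsIrreducible] :
    finrank ℂ V ∣ Nat.card K := by
  have : IsMulCommutative (⊥ : Subgroup K) := ⟨⟨fun a b => Subsingleton.elim _ _⟩⟩
  have h := finrank_dvd_card_of_isComplement' ρ (Subgroup.isComplement'_bot_top (G := K))
  rwa [Subgroup.card_top] at h

/-- The values of the central character are algebraic integers. -/
theorem isIntegral_centralChar (ρ : Representation ℂ K V) [ρ.IsIrreducible] (g : K) :
    IsIntegral ℤ (centralChar ρ.character g) := by
  classical
  have hnt := nontrivial_of_isIrreducible ρ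
  have := Fintype.ofFinite K
  obtain ⟨v, hv⟩ := exists_ne (0 : V)
  let s : Finset K := (conjugatesOf g).toFinset
  have hs : ∀ x, x ∈ s ↔ IsConj g x := fun x => by
    rw [Set.mem_toFinset]
    rfl
  have hconj : ∀ k x, IsConj g x ↔ IsConj g (k * x * k⁻¹) := fun k x =>
    ⟨fun h => h.trans (isConj_iff.2 ⟨k, rfl⟩), fun h => h.trans (isConj_iff.2 ⟨k⁻¹, by group⟩)⟩
  have hcomm : ∀ k, ρ k * (∑ x ∈ s, ρ x) = (∑ x ∈ s, ρ x) * ρ k := by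
    intro k
    rw [Finset.mul_sum, Finset.sum_mul]
    refine Finset.sum_equiv (MulAut.conj k).toEquiv (fun x => ?_) fun x _ => ?_
    · rw [hs, hs]
      exact hconj k x
    · rw [← map_mul, ← map_mul]
      congr 1
      change k * x = k * x * k⁻¹ * k
      group
  have hsum : ∑ x ∈ s, ρ x = centralChar ρ.character g • 1 := by
    rw [eq_trace_div_finrank_smul_one (ρ := ρ) _ hcomm, map_sum, centralChar,
      Representation.char_one]
    congr 2
    have : ∀ x ∈ s, LinearMap.trace ℂ V (ρ x) = ρ.character g := fun x hx => by
      obtain ⟨k, rfl⟩ := isConj_iff.1 ((hs x).1 hx)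
      exact ρ.char_conj g k
    rw [Finset.sum_congr rfl this, Finset.sum_const, nsmul_eq_mul]
    simp [s]
  -- The class sum is a scalar and permutes the orbit vectors `ρ t v` additively, so that scalar is
  -- an eigenvalue of a zero-one matrix.
  refine isIntegral_of_smul_eq_sum (ι := K) (s := fun t => s.image (· * t))
    (v := fun t => ρ t v) (F := fun _ _ => 1) (i := 1) (fun _ _ => isIntegral_one) (fun t => ?_)
    (by simpa using hv)
  rw [Finset.sum_image fun x _ y _ h => mul_right_cancel h]
  have h1 := LinearMap.congr_fun hsum (ρ t v)
  simp only [LinearMap.sum_apply, LinearMap.smul_apply, Module.End.one_apply] at h1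
  rw [← h1]
  refine Finset.sum_congr rfl fun x _ => ?_
  rw [one_smul, map_mul, Module.End.mul_apply]

/-- A representation of a `p`-group of degree prime to `p` has a linear constituent. -/
theorem exists_linear_of_isPGroup {p : ℕ} [hp : Fact p.Prime] (hK : IsPGroup p K)
    (ρ : Representation ℂ K V) (hV : ¬ p ∣ finrank ℂ V) :
    ∃ (lam : K →* ℂ) (v : V), v ≠ 0 ∧ ∀ x, ρ x v = lam x • v := by
  obtain ⟨S, hS, hmin⟩ := exists_minimal_subrepresentation
    (fun S : Subrepresentation ρ => ¬ p ∣ finrank ℂ S.toSubmodule) ⟨⊤, by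
      change ¬ p ∣ finrank ℂ (⊤ : Submodule ℂ V)
      rwa [finrank_top]⟩
  have hSb : S ≠ ⊥ := by
    rintro rfl
    apply hS
    change p ∣ finrank ℂ (⊥ : Submodule ℂ V)
    simp
  -- If `T ≤ S` has dimension divisible by `p`, its complement in `S` has dimension prime to `p`, so
  -- it is `S` by minimality and `T` is zero.
  have hirr : S.toRepresentation.IsIrreducible := by
    refine isIrreducible_toRepresentation S hSb fun T hT => ?_
    by_cases hTd : p ∣ finrank ℂ T.toSubmodule
    · left
      obtain ⟨T', hT'⟩ := exists_isCompl T
      have hd : (T ⊓ (T' ⊓ S)) = ⊥ := by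
        rw [← inf_assoc, hT'.inf_eq_bot, bot_inf_eq]
      have hm : T.toSubmodule ⊔ (T' ⊓ S).toSubmodule = S.toSubmodule := by
        apply le_antisymm (sup_le (α := Submodule ℂ V) hT inf_le_right)
        intro v hv
        have hv' : v ∈ T.toSubmodule ⊔ T'.toSubmodule := by
          have : T.toSubmodule ⊔ T'.toSubmodule = ⊤ :=
            congrArg Subrepresentation.toSubmodule hT'.sup_eq_top
          rw [this]; exact Submodule.mem_top
        obtain ⟨a, ha, b, hb, rfl⟩ := Submodule.mem_sup.1 hv'
        refine Submodule.mem_sup.2 ⟨a, ha, b, ⟨hb, ?_⟩, rfl⟩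
        have : a + b - a ∈ S.toSubmodule := S.toSubmodule.sub_mem hv (hT ha)
        rwa [add_sub_cancel_left] at this
      have hdim := Submodule.finrank_sup_add_finrank_inf_eq T.toSubmodule (T' ⊓ S).toSubmodule
      have hd' : T.toSubmodule ⊓ (T' ⊓ S).toSubmodule = ⊥ :=
        congrArg Subrepresentation.toSubmodule hd
      rw [hm, hd', finrank_bot, add_zero] at hdim
      have hnd : ¬ p ∣ finrank ℂ (T' ⊓ S).toSubmodule := fun h =>
        hS (hdim ▸ Nat.dvd_add hTd h)
      have he : T' ⊓ S = S := hmin _ hnd inf_le_right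
      rw [he, inf_eq_left.2 hT] at hd
      exact hd
    · exact Or.inr (hmin T hTd hT)
  refine exists_linear_of_finrank_eq_one S ?_
  obtain ⟨n, hn⟩ := IsPGroup.iff_card.1 hK
  have h1 := finrank_dvd_card S.toRepresentation
  rw [hn, Nat.dvd_prime_pow hp.out] at h1
  obtain ⟨k, -, hk⟩ := h1
  rcases k with _ | k
  · simpa using hk
  · exact absurd (hk ▸ dvd_pow_self p k.succ_ne_zero) hS

end Degree

/-! ### Conjugacy in groups with an abelian normal Sylow subgroup -/

section Averaging

variable {K : Type*} [Group K]

/-- The elements `z ^ i * (x ^ i)⁻¹` form a cocycle with values in `Q`, and `w` is their product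
over `i < n`. Conjugation by `z` shifts the product by one index, up to factors of `z * x⁻¹`. It is
the explicit averaging behind the vanishing of first cohomology. -/
lemma conj_prod_eq {Q : Subgroup K} [hQ : Q.Normal] (hcomm : ∀ a ∈ Q, ∀ b ∈ Q, a * b = b * a)
    {x z : K} (hzx : z * x⁻¹ ∈ Q) (n : ℕ) :
    ∃ w ∈ Q, z ^ n * (x ^ n)⁻¹ ∈ Q ∧
      z * w * z⁻¹ = w * (z ^ n * (x ^ n)⁻¹) * ((z * x⁻¹)⁻¹) ^ n := by
  induction n with
  | zero => exact ⟨1, Q.one_mem, by simp, by simp⟩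
  | succ n ih =>
    obtain ⟨w, hw, hf, he⟩ := ih
    set f := z ^ n * (x ^ n)⁻¹ with hfdef
    have hzf : z * f * z⁻¹ ∈ Q := hQ.conj_mem f hf z
    have hfs : z ^ (n + 1) * (x ^ (n + 1))⁻¹ = z * f * z⁻¹ * (z * x⁻¹) := by
      rw [hfdef, pow_succ' z, pow_succ x]
      group
    have hinv : (z * x⁻¹)⁻¹ ∈ Q := Q.inv_mem hzx
    refine ⟨w * f, Q.mul_mem hw hf, ?_, ?_⟩
    · rw [hfs]
      exact Q.mul_mem hzf hzx
    · have e1 : z * (w * f) * z⁻¹ = (z * w * z⁻¹) * (z * f * z⁻¹) := by group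
      rw [e1, he, hfs, pow_succ', mul_assoc (w * f) (_ ^ n), hcomm _ (Q.pow_mem hinv n) _ hzf]
      generalize z * x⁻¹ = t
      generalize z * f * z⁻¹ = e
      group

/-- Two elements of order prime to `p` which agree modulo an elementary abelian normal subgroup are
conjugate under that subgroup. -/
lemma exists_conj_eq_of_mul_inv_mem {Q : Subgroup K} [Q.Normal]
    (hcomm : ∀ a ∈ Q, ∀ b ∈ Q, a * b = b * a) {p m : ℕ} (hexp : ∀ q ∈ Q, q ^ p = 1)
    (hpm : m.Coprime p) (hp : 1 < p) {x z : K} (hx : x ^ m = 1) (hz : z ^ m = 1)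
    (hzx : z * x⁻¹ ∈ Q) : ∃ q ∈ Q, q * x * q⁻¹ = z := by
  obtain ⟨w, hw, -, he⟩ := conj_prod_eq hcomm hzx m
  rw [hx, hz, inv_one, mul_one, mul_one] at he
  -- With `x ^ m = z ^ m = 1` the cocycle closes up and `z` multiplies `w` by `(z * x⁻¹)⁻¹ ^ m`;
  -- inverting `m` modulo `p` replaces `w` by `w ^ r` and removes the exponent.
  obtain ⟨r, -, hr⟩ := Nat.exists_mul_mod_eq_one_of_coprime hpm hp
  have hinv : (z * x⁻¹)⁻¹ ∈ Q := Q.inv_mem hzx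
  have h1 : z * w ^ r * z⁻¹ = w ^ r * (z * x⁻¹)⁻¹ := by
    have hc : Commute w (((z * x⁻¹)⁻¹) ^ m) := hcomm _ hw _ (Q.pow_mem hinv m)
    rw [← conj_pow, he, hc.mul_pow, ← pow_mul,
      pow_eq_pow_of_modEq (show m * r ≡ 1 [MOD p] by rw [Nat.ModEq, hr, Nat.mod_eq_of_lt hp])
        (hexp _ hinv), pow_one]
  refine ⟨w ^ r, Q.pow_mem hw r, ?_⟩
  have h2 : z * w ^ r = w ^ r * x := by
    have := congrArg (· * z) h1
    simpa [mul_assoc] using this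
  rw [← h2, mul_inv_cancel_right]

end Averaging

/-! ### Automizers of cyclic subgroups -/

section Automizer

variable {K : Type*} [Group K]

lemma mem_normalizer_zpowers_of_conj_eq_pow {y k : K} {j i : ℕ} (hk : k * y * k⁻¹ = y ^ j)
    (hi : (y ^ j) ^ i = y) : k ∈ Subgroup.normalizer (Subgroup.zpowers y : Set K) := by
  rw [Subgroup.mem_normalizer_iff]
  intro h
  constructor
  · rintro ⟨z, rfl⟩
    refine Subgroup.mem_zpowers_iff.2 ⟨j * z, ?_⟩
    rw [← conj_zpow, hk, zpow_mul, zpow_natCast]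
  · rintro ⟨z, hz⟩
    refine Subgroup.mem_zpowers_iff.2 ⟨i * z, ?_⟩
    have h1 : k * y ^ i * k⁻¹ = y := by rw [← conj_pow, hk, hi]
    have h2 : k * y ^ ((i : ℤ) * z) * k⁻¹ = k * h * k⁻¹ := by
      rw [zpow_mul, zpow_natCast, ← conj_zpow, h1]
      exact hz
    simpa using h2

lemma conj_eq_pow_of_mem_normalizer [Finite K] {y a : K}
    (ha : a ∈ Subgroup.normalizer (Subgroup.zpowers y : Set K)) :
    ∃ j : ℕ, a * y * a⁻¹ = y ^ j := by
  have h := (Subgroup.mem_normalizer_iff.1 ha y).1 (Subgroup.mem_zpowers y)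
  obtain ⟨j, hj⟩ := (mem_powers_iff_mem_zpowers).2 h
  exact ⟨j, hj.symm⟩

lemma ker_normalizerMonoidHom_zpowers (y : K) :
    (Subgroup.zpowers y).normalizerMonoidHom.ker =
      (Subgroup.centralizer {y}).subgroupOf
        (Subgroup.normalizer (Subgroup.zpowers y : Set K)) := by
  rw [Subgroup.normalizerMonoidHom_ker, ← Subgroup.centralizer_closure {y},
    ← Subgroup.zpowers_eq_closure]

/-- `N_K(⟨y⟩) / C_K(y) ≅ Aut(⟨y⟩)` means that every automorphism is induced by conjugation. -/
lemma fullAutomizer_iff_surjective [Finite K] (y : K) :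
    FullAutomizer y ↔ Function.Surjective (Subgroup.zpowers y).normalizerMonoidHom := by
  constructor
  · rintro ⟨e⟩
    -- The given isomorphism is abstract and need not come from conjugation; by finiteness, equality
    -- of orders is enough.
    have h1 : Nat.card (Subgroup.zpowers y).normalizerMonoidHom.range =
        Nat.card (MulAut (Subgroup.zpowers y)) := by
      rw [← Subgroup.index_ker, ker_normalizerMonoidHom_zpowers]
      exact Nat.card_congr e.toEquiv
    rw [← MonoidHom.range_eq_top]
    exact Subgroup.eq_top_of_card_eq _ h1
  · intro h
    exact ⟨(QuotientGroup.quotientMulEquivOfEq (ker_normalizerMonoidHom_zpowers y).symm).trans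
      (QuotientGroup.quotientKerEquivOfSurjective _ h)⟩

lemma exists_conj_eq_pow_of_fullAutomizer [Finite K] {y : K} (h : FullAutomizer y) {s : ℕ}
    (hs : (orderOf y).Coprime s) :
    ∃ a ∈ Subgroup.normalizer (Subgroup.zpowers y : Set K), a * y * a⁻¹ = y ^ s := by
  rw [fullAutomizer_iff_surjective] at h
  have hs' : (Nat.card (Subgroup.zpowers y)).Coprime s := by rwa [Nat.card_zpowers]
  let α : MulAut (Subgroup.zpowers y) :=
    { powCoprime hs' with
      map_mul' := fun a b => by
        change (a * b) ^ s = a ^ s * b ^ s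
        have hab : Commute a b := Subtype.ext (by
          obtain ⟨i, hi⟩ := a.2
          obtain ⟨j, hj⟩ := b.2
          simp only at hi hj
          rw [Subgroup.coe_mul, Subgroup.coe_mul, ← hi, ← hj]
          exact (Commute.refl y).zpow_zpow i j)
        exact hab.mul_pow s }
  obtain ⟨a, ha⟩ := h α
  refine ⟨a, a.2, ?_⟩
  have := congrArg Subtype.val (DFunLike.congr_fun ha ⟨y, Subgroup.mem_zpowers y⟩)
  exact this

/-- Every automorphism of a cyclic group is a power map with exponent prime to the order, and a
conjugation inducing it automatically normalizes the subgroup. -/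
lemma fullAutomizer_of_exists_conj [Finite K] {y : K}
    (h : ∀ j : ℕ, (orderOf y).Coprime j → ∃ a, a * y * a⁻¹ = y ^ j) : FullAutomizer y := by
  rw [fullAutomizer_iff_surjective]
  intro α
  obtain ⟨j, hj⟩ := (mem_powers_iff_mem_zpowers).2 (α ⟨y, Subgroup.mem_zpowers y⟩).2
  have hord : orderOf (y ^ j) = orderOf y := by
    have h1 : orderOf (α ⟨y, Subgroup.mem_zpowers y⟩) = orderOf y := by
      rw [MulEquiv.orderOf_eq, Subgroup.orderOf_mk]
    rw [← h1, ← Subgroup.orderOf_coe, ← hj]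
  have hcop : (orderOf y).Coprime j := by
    rw [orderOf_pow] at hord
    exact (Nat.div_eq_self.1 hord).resolve_left (orderOf_pos y).ne'
  obtain ⟨a, ha⟩ := h j hcop
  obtain ⟨i, hi⟩ : ∃ i, (y ^ j) ^ i = y := by
    have : y ∈ Subgroup.zpowers (y ^ j) := by
      have he : Subgroup.zpowers (y ^ j) = Subgroup.zpowers y := by
        refine Subgroup.eq_of_le_of_card_ge (Subgroup.zpowers_le.2 ?_) ?_
        · exact Subgroup.pow_mem _ (Subgroup.mem_zpowers y) j
        · rw [Nat.card_zpowers, Nat.card_zpowers, hord]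
      exact he ▸ Subgroup.mem_zpowers y
    exact (mem_powers_iff_mem_zpowers).2 this
  refine ⟨⟨a, mem_normalizer_zpowers_of_conj_eq_pow ha hi⟩, MulEquiv.ext fun ⟨z, hz⟩ => ?_⟩
  obtain ⟨n, rfl⟩ := (mem_powers_iff_mem_zpowers).2 hz
  have e : (⟨y ^ n, hz⟩ : Subgroup.zpowers y) = ⟨y, Subgroup.mem_zpowers y⟩ ^ n := rfl
  simp only
  rw [e, map_pow, map_pow]
  congr 1
  apply Subtype.ext
  rw [← hj]
  exact ha

end Automizer

/-! ### Conjugacy to powers in terms of automizers -/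

section Criterion

variable {K : Type*} [Group K] [Finite K] {p m : ℕ} [hp : Fact p.Prime]

/-- The local criterion: for an elementary abelian normal Sylow `p`-subgroup `Q` and `m` a multiple
of the exponent of `K / Q` prime to `p`, all elements are conjugate to their powers with exponent
congruent to one modulo `m` exactly when each nontrivial element `y` of `Q` has full automizer and
the automizer acts trivially on the classes of `C_K(y) / Q`. -/
theorem forall_isConj_pow_iff (Q : Subgroup K) [hQ : Q.Normal]
    (hcomm : ∀ a ∈ Q, ∀ b ∈ Q, a * b = b * a) (hexp : ∀ q ∈ Q, q ^ p = 1)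
    (hm : ¬ p ∣ m) (hmQ : ∀ g : K, g ^ m ∈ Q) :
    (∀ s : ℕ, s.Coprime p → s ≡ 1 [MOD m] → ∀ g : K, IsConj g (g ^ s)) ↔
      ∀ y ∈ Q, y ≠ 1 → FullAutomizer y ∧ TrivialOnCentralizerClasses Q y := by
  have hmp : m.Coprime p := ((Nat.Prime.coprime_iff_not_dvd hp.out).2 hm).symm
  have hord : ∀ y ∈ Q, y ≠ 1 → orderOf y = p := fun y hy hy1 =>
    orderOf_eq_prime (hexp y hy) hy1
  -- an exponent which extracts the component of order prime to `p`
  obtain ⟨u, hu0, hu1⟩ := Nat.chineseRemainder hmp.symm 0 1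
  have hup : p ∣ u := (Nat.modEq_zero_iff_dvd).1 hu0
  have hmod : ∀ g : K, g ^ u * g⁻¹ ∈ Q := by
    intro g
    rw [← QuotientGroup.eq_one_iff, QuotientGroup.mk_mul, QuotientGroup.mk_inv,
      QuotientGroup.mk_pow, mul_inv_eq_one]
    have h1 : (g : K ⧸ Q) ^ m = 1 := by
      rw [← QuotientGroup.mk_pow, QuotientGroup.eq_one_iff]
      exact hmQ g
    rw [pow_eq_pow_of_modEq hu1 h1, pow_one]
  have hum : ∀ g : K, (g ^ u) ^ m = 1 := by
    intro g
    obtain ⟨d, hd⟩ := hup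
    rw [← pow_mul, hd, show p * d * m = m * p * d by ring, pow_mul, pow_mul, hexp _ (hmQ g),
      one_pow]
  constructor
  · intro h y hy hy1
    have hoy := hord y hy hy1
    have hyp : y ^ p = 1 := hexp y hy
    have hCRT : ∀ j : ℕ, p.Coprime j → ∃ s : ℕ, s.Coprime p ∧ s ≡ 1 [MOD m] ∧ s ≡ j [MOD p] := by
      intro j hj
      obtain ⟨s, hs1, hs2⟩ := Nat.chineseRemainder hmp 1 j
      refine ⟨s, ?_, hs1, hs2⟩
      rw [Nat.Coprime, hs2.gcd_eq]
      exact hj.symm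
    refine ⟨fullAutomizer_of_exists_conj fun j hj => ?_, ?_⟩
    · rw [hoy] at hj
      obtain ⟨s, hs, hs1, hs2⟩ := hCRT j hj
      obtain ⟨a, ha⟩ := isConj_iff.1 (h s hs hs1 y)
      exact ⟨a, by rw [ha, pow_eq_pow_of_modEq hs2 hyp]⟩
    · rintro _ ⟨a, ha, rfl⟩ _ ⟨b, hb, rfl⟩
      obtain ⟨j, hj⟩ := conj_eq_pow_of_mem_normalizer ha
      have hb' : Commute y b := (Subgroup.mem_centralizer_singleton_iff.1 hb).symm
      have hjp : p.Coprime j := by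
        refine (Nat.Prime.coprime_iff_not_dvd hp.out).2 fun hd => hy1 ?_
        rw [pow_eq_one_of_dvd_of_pow_eq_one hd hyp] at hj
        simpa using hj
      obtain ⟨s, hs, hs1, hs2⟩ := hCRT j hjp
      -- Passing from `b` to `b ^ u` keeps the coset modulo `Q` and makes the order prime to `p`. An
      -- element `k` conjugating `y * b ^ u` to its `s`-th power then acts on the two factors
      -- separately, and `a * k⁻¹` is the required element of the centralizer of `y`.
      have hyx : Commute y (b ^ u) := hb'.pow_right u
      obtain ⟨k, hk⟩ := isConj_iff.1 (h s hs hs1 (y * b ^ u))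
      have hs3 : (y * b ^ u) ^ s = y ^ j * b ^ u := by
        rw [hyx.mul_pow, pow_eq_pow_of_modEq hs2 hyp, pow_eq_pow_of_modEq hs1 (hum b), pow_one]
      rw [hs3] at hk
      have hux : (b ^ u) ^ u = b ^ u := by
        conv_rhs => rw [← pow_one (b ^ u)]
        exact pow_eq_pow_of_modEq hu1 (hum b)
      have hkx : k * b ^ u * k⁻¹ = b ^ u := by
        have h1 := congrArg (· ^ u) hk
        simp only [conj_pow] at h1
        rwa [hyx.mul_pow, (hyx.pow_left j).mul_pow, pow_eq_one_of_dvd_of_pow_eq_one hup hyp,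
          pow_eq_one_of_dvd_of_pow_eq_one hup (show (y ^ j) ^ p = 1 by
            rw [← pow_mul, mul_comm, pow_mul, hyp, one_pow]), hux, one_mul] at h1
      have hky : k * y * k⁻¹ = y ^ j := by
        have h1 : (k * y * k⁻¹) * (k * b ^ u * k⁻¹) = y ^ j * b ^ u := by rw [← hk]; group
        rw [hkx] at h1
        exact mul_right_cancel h1
      obtain ⟨i, -, hi⟩ := Nat.exists_mul_mod_eq_one_of_coprime hjp.symm hp.out.one_lt
      have hi' : (y ^ j) ^ i = y := by
        rw [← pow_mul, pow_eq_pow_of_modEq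
          (show j * i ≡ 1 [MOD p] by rw [Nat.ModEq, hi, Nat.mod_eq_of_lt hp.out.one_lt]) hyp,
          pow_one]
      refine ⟨QuotientGroup.mk' Q (a * k⁻¹), ⟨a * k⁻¹, ?_, rfl⟩, ?_⟩
      · refine Subgroup.mem_centralizer_singleton_iff.2 ?_
        have h1 : (a * k⁻¹) * y ^ j * (a * k⁻¹)⁻¹ = y ^ j := by
          conv_lhs => rw [← hky]
          rw [← hj]
          group
        have h2 : (a * k⁻¹) * y * (a * k⁻¹)⁻¹ = y := by
          rw [← hi', ← conj_pow, h1]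
        exact mul_inv_eq_iff_eq_mul.1 h2
      · have hb2 : (QuotientGroup.mk' Q) b = (QuotientGroup.mk' Q) (b ^ u) := by
          have := (QuotientGroup.eq_one_iff _).2 (hmod b)
          rw [QuotientGroup.mk_mul, QuotientGroup.mk_inv, mul_inv_eq_one] at this
          exact this.symm
        rw [hb2, ← map_inv, ← map_inv, ← map_mul, ← map_mul, ← map_mul, ← map_mul]
        congr 1
        have : k⁻¹ * b ^ u * k = b ^ u := by
          conv_lhs => rw [← hkx]
          group
        calc a * k⁻¹ * b ^ u * (a * k⁻¹)⁻¹ = a * (k⁻¹ * b ^ u * k) * a⁻¹ := by group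
          _ = a * b ^ u * a⁻¹ := by rw [this]
  · intro h s hs hs1 g
    set x := g ^ u with hx
    set y := g * x⁻¹ with hydef
    have hgx : Commute g x := (Commute.refl g).pow_right u
    have hyx : Commute y x := hgx.mul_left (Commute.refl x).inv_left
    have hy : y ∈ Q := by
      have := Q.inv_mem (hmod g)
      rwa [mul_inv_rev, inv_inv] at this
    have hg : g = y * x := by rw [hydef, inv_mul_cancel_right]
    have hxm : x ^ m = 1 := hum g
    have hgs : g ^ s = y ^ s * x := by
      rw [hg, hyx.mul_pow, pow_eq_pow_of_modEq hs1 hxm, pow_one]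
    by_cases hy1 : y = 1
    · rw [hgs, hg, hy1, one_pow]
    obtain ⟨hfull, htriv⟩ := h y hy hy1
    obtain ⟨a, haN, ha⟩ := exists_conj_eq_pow_of_fullAutomizer hfull
      (s := s) (by rw [hord y hy hy1]; exact hs.symm)
    obtain ⟨_, ⟨c, hc, rfl⟩, hcx⟩ := htriv _ ⟨a, haN, rfl⟩ _
      ⟨x, Subgroup.mem_centralizer_singleton_iff.2 hyx.symm, rfl⟩
    have hc' : Commute y c := (Subgroup.mem_centralizer_singleton_iff.1 hc).symm
    -- Correcting `a` by `c`, which centralizes `y`, gives an element that sends `y` to `y ^ s` and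
    -- fixes `x` modulo `Q`. A last conjugation by `q ∈ Q` fixes `x` exactly without moving `y ^ s`,
    -- since `Q` is abelian.
    set k := c⁻¹ * a with hk
    have hky : k * y * k⁻¹ = y ^ s := by
      calc k * y * k⁻¹ = c⁻¹ * (a * y * a⁻¹) * c := by rw [hk]; group
        _ = c⁻¹ * (c * y ^ s) := by rw [ha, mul_assoc, (hc'.pow_left s).eq]
        _ = y ^ s := by group
    have hkx : x * (k * x * k⁻¹)⁻¹ ∈ Q := by
      rw [← QuotientGroup.eq_one_iff]
      have h1 : QuotientGroup.mk' Q (a * x * a⁻¹) = QuotientGroup.mk' Q (c * x * c⁻¹) := by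
        simp only [map_mul, map_inv]
        exact hcx.symm
      have h2 : QuotientGroup.mk' Q (k * x * k⁻¹) = QuotientGroup.mk' Q x := by
        calc QuotientGroup.mk' Q (k * x * k⁻¹)
            = QuotientGroup.mk' Q (c⁻¹ * (a * x * a⁻¹) * c) := by
              congr 1
              rw [hk]
              group
          _ = QuotientGroup.mk' Q (c⁻¹ * (c * x * c⁻¹) * c) := by
              rw [map_mul, map_mul, h1, ← map_mul, ← map_mul]
          _ = QuotientGroup.mk' Q x := by
              congr 1
              group
      change QuotientGroup.mk' Q (x * (k * x * k⁻¹)⁻¹) = 1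
      rw [map_mul, map_inv, h2, mul_inv_cancel]
    obtain ⟨q, hq, hqx⟩ := exists_conj_eq_of_mul_inv_mem hcomm hexp hmp hp.out.one_lt
      (x := k * x * k⁻¹) (z := x) (by rw [conj_pow, hxm]; group) hxm hkx
    refine isConj_iff.2 ⟨q * k, ?_⟩
    rw [hgs]
    calc q * k * g * (q * k)⁻¹ = q * (k * y * k⁻¹) * q⁻¹ * (q * (k * x * k⁻¹) * q⁻¹) := by
          conv_lhs => rw [hg]
          group
      _ = y ^ s * x := by
          rw [hqx, hky, hcomm q hq _ (Q.pow_mem hy s), mul_inv_cancel_right]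

end Criterion

/-! ### The Frattini quotient of a `p`-group -/

section Frattini

variable {P : Type*} [Group P] [Finite P] {p : ℕ} [hp : Fact p.Prime]

/-- Every maximal subgroup of a `p`-group is the kernel of a map onto a group of order `p`. -/
lemma pow_mem_and_commutator_mem_of_isCoatom (hP : IsPGroup p P) {M : Subgroup P}
    (hM : IsCoatom M) : (∀ x : P, x ^ p ∈ M) ∧ ∀ a b : P, a * b * (b * a)⁻¹ ∈ M := by
  have hN : M.Normal :=
    (Group.isNilpotent_of_finite_tfae.out 0 2 rfl rfl).1 hP.isNilpotent M hM
  have hnt : Nontrivial (P ⧸ M) := QuotientGroup.nontrivial_iff.2 hM.1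
  obtain ⟨n, hn, hcard⟩ := IsPGroup.nontrivial_iff_card (hP.to_quotient M) |>.1 hnt
  obtain ⟨z, hz⟩ := exists_prime_orderOf_dvd_card' (G := P ⧸ M) p
    (hcard ▸ dvd_pow_self p hn.ne')
  have htop : ∀ x : P ⧸ M, x ∈ Subgroup.zpowers z := by
    have h1 : M < (Subgroup.zpowers z).comap (QuotientGroup.mk' M) := by
      refine lt_of_le_of_ne (fun x hx => ?_) fun he => ?_
      · rw [Subgroup.mem_comap, QuotientGroup.mk'_apply, (QuotientGroup.eq_one_iff x).2 hx]
        exact Subgroup.one_mem _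
      · obtain ⟨w, rfl⟩ := QuotientGroup.mk'_surjective M z
        have : w ∈ M := he ▸ (Subgroup.mem_comap.2 (Subgroup.mem_zpowers _))
        rw [QuotientGroup.mk'_apply, (QuotientGroup.eq_one_iff w).2 this, orderOf_one] at hz
        exact hp.out.one_lt.ne hz
    have h2 := hM.2 _ h1
    intro x
    obtain ⟨w, rfl⟩ := QuotientGroup.mk'_surjective M x
    have : w ∈ (Subgroup.zpowers z).comap (QuotientGroup.mk' M) := h2 ▸ Subgroup.mem_top w
    exact this
  constructor
  · intro x
    rw [← QuotientGroup.eq_one_iff, QuotientGroup.mk_pow]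
    obtain ⟨k, hk⟩ := htop x
    simp only at hk
    rw [← hk, ← zpow_natCast, ← zpow_mul, mul_comm, zpow_mul, zpow_natCast, ← hz,
      pow_orderOf_eq_one, one_zpow]
  · intro a b
    rw [← QuotientGroup.eq_one_iff, QuotientGroup.mk_mul, QuotientGroup.mk_inv, mul_inv_eq_one,
      QuotientGroup.mk_mul, QuotientGroup.mk_mul]
    obtain ⟨i, hi⟩ := htop a
    obtain ⟨j, hj⟩ := htop b
    simp only at hi hj
    rw [← hi, ← hj]
    exact (Commute.refl z).zpow_zpow i j

lemma mem_frattini_iff {G : Type*} [Group G] (x : G) :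
    x ∈ frattini G ↔ ∀ M : Subgroup G, IsCoatom M → x ∈ M := by
  simp [frattini, Order.radical, Subgroup.mem_iInf]

lemma pow_mem_frattini (hP : IsPGroup p P) (x : P) : x ^ p ∈ frattini P :=
  (mem_frattini_iff _).2 fun _ hM => (pow_mem_and_commutator_mem_of_isCoatom hP hM).1 x

lemma commutator_mem_frattini (hP : IsPGroup p P) (a b : P) : a * b * (b * a)⁻¹ ∈ frattini P :=
  (mem_frattini_iff _).2 fun _ hM => (pow_mem_and_commutator_mem_of_isCoatom hP hM).2 a b

/-- A linear character of order dividing `p` is trivial on the Frattini subgroup. -/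
lemma eq_one_of_mem_frattini {lam : P →* ℂ} (hlam : ∀ x, lam x ^ p = 1) {x : P}
    (hx : x ∈ frattini P) : lam x = 1 := by
  by_contra h
  have hprim : IsPrimitiveRoot (lam x) p := by
    rw [IsPrimitiveRoot.iff_orderOf]
    exact orderOf_eq_prime (hlam x) h
  -- A nontrivial value at `x` generates all `p`-th roots of unity, so the kernel and `x` generate
  -- `P`; the Frattini subgroup can be dropped from a generating set.
  have htop : lam.ker = ⊤ := by
    refine frattini_nongenerating (eq_top_iff.2 fun y _ => ?_)
    obtain ⟨k, -, hk⟩ := hprim.eq_pow_of_pow_eq_one (hlam y)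
    have h1 : y * (x ^ k)⁻¹ ∈ lam.ker := by
      rw [MonoidHom.mem_ker, map_mul, ← hk, ← map_pow, monoidHom_mul_inv]
    have h2 := Subgroup.mul_mem_sup h1 (Subgroup.pow_mem _ hx k)
    rwa [inv_mul_cancel_right] at h2
  exact h (lam.mem_ker.1 (htop ▸ Subgroup.mem_top x))

end Frattini

/-! ### Groups with a normal Sylow subgroup -/

section NormalSylow

variable {X V : Type*} [Group X] [Finite X] [AddCommGroup V] [Module ℂ V] [FiniteDimensional ℂ V]
  {p : ℕ} [hp : Fact p.Prime] (P : Sylow p X) [hPn : (P : Subgroup X).Normal]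

omit [FiniteDimensional ℂ V] hPn in
lemma index_sylow_eq_ordCompl : (P : Subgroup X).index = ordCompl[p] (Nat.card X) := by
  have h := (P : Subgroup X).card_mul_index
  rw [P.card_eq_multiplicity] at h
  have h0 : 0 < p ^ (Nat.card X).factorization p := pow_pos hp.out.pos _
  exact (Nat.div_eq_of_eq_mul_right h0 h.symm).symm

lemma pow_ordCompl_mem_sylow (x : X) : x ^ ordCompl[p] (Nat.card X) ∈ (P : Subgroup X) := by
  rw [← index_sylow_eq_ordCompl P]
  exact Subgroup.pow_index_mem _ x

/-- An almost `p`-rational character of degree prime to `p` contains the Frattini subgroup of the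
normal Sylow `p`-subgroup in its kernel. -/
theorem apply_eq_one_of_mem_frattiniOf (ρ : Representation ℂ X V) [ρ.IsIrreducible]
    (hdeg : ¬ p ∣ finrank ℂ V) (halm : IsAlmostPRational p ρ.character) {x : X}
    (hx : x ∈ frattiniOf (P : Subgroup X)) : ρ x = 1 := by
  let := Fintype.ofFinite P
  have hX : Nat.card X ≠ 0 := Nat.card_pos.ne'
  let ρP : Representation ℂ P V := ρ.comp (P : Subgroup X).subtype
  obtain ⟨lam, v, hv0, hv⟩ := exists_linear_of_isPGroup P.isPGroup' ρP hdeg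
  set m := ordCompl[p] (Nat.card X) with hm
  have hpm : p.Coprime m := (Nat.Prime.coprime_iff_not_dvd hp.out).2 (Nat.not_dvd_ordCompl hp.out hX)
  -- This exponent fixes every almost `p`-rational character, yet `s ^ m - 1` is only `p` times a
  -- number prime to `p`.
  set s := p * m + 1 with hs
  have hsp : s.Coprime p := by
    rw [hs, add_comm]
    simp
  have hsX : s.Coprime (Nat.card X) := by
    rw [← Nat.ordProj_mul_ordCompl_eq_self (Nat.card X) p]
    refine Nat.Coprime.mul_right (hsp.pow_right _) ?_
    rw [← hm, hs, add_comm]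
    simp
  have hs1 : s ≡ 1 [MOD p * m] := by
    rw [hs]
    simp [Nat.ModEq]
  have hsP : (Nat.card P).Coprime s := by
    rw [P.card_eq_multiplicity]
    exact (hsp.pow_right _).symm
  -- the multiplicities of `lam` and `lam ^ s` agree
  have htr : LinearMap.trace ℂ V (isotypicProj ρP (lam ^ s)) =
      LinearMap.trace ℂ V (isotypicProj ρP lam) := by
    rw [trace_isotypicProj, trace_isotypicProj]
    congr 1
    refine Fintype.sum_equiv (powCoprime hsP) _ _ fun q => ?_
    rw [powCoprime_apply, MonoidHom.pow_apply, ← map_pow, inv_pow]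
    congr 1
    exact (halm.character_pow ρ p hsX hs1 q).symm
  have hne : isotypicProj ρP (lam ^ s) ≠ 0 := by
    intro h
    rw [h, map_zero] at htr
    exact trace_isotypicProj_ne_zero ρP lam hv0 hv htr.symm
  -- Clifford's argument: the vectors whose whole orbit is killed by the projection form a proper
  -- invariant subspace, hence zero. So `lam ^ s` is a conjugate of `lam`, by some `n`.
  obtain ⟨n, hn⟩ : ∃ n, isotypicProj ρP (lam ^ s) (ρ n v) ≠ 0 := by
    by_contra! hall
    let W : Submodule ℂ V := ⨅ n, LinearMap.ker (isotypicProj ρP (lam ^ s) * ρ n)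
    have hmem : ∀ w, w ∈ W ↔ ∀ n, isotypicProj ρP (lam ^ s) (ρ n w) = 0 := fun w => by
      simp [W, Submodule.mem_iInf]
    rcases eq_bot_or_eq_top_of_invariant (ρ := ρ) W (by
      intro g w hw
      rw [hmem] at hw ⊢
      intro k
      have := hw (k * g)
      rwa [map_mul] at this) with hW | hW
    · exact hv0 ((Submodule.mem_bot ℂ).1 (hW ▸ (hmem v).2 hall))
    · refine hne (LinearMap.ext fun w => ?_)
      have := (hmem w).1 (hW ▸ Submodule.mem_top) 1
      simpa using this
  let c : P → P := fun y => ⟨n⁻¹ * y * n, by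
    have := hPn.conj_mem y y.2 n⁻¹
    rwa [inv_inv] at this⟩
  have hc : ∀ y, lam (c y) = lam y ^ s := by
    intro y
    have h1 : isotypicProj ρP (lam ^ s) (ρP y (ρ n v)) =
        (lam ^ s) y • isotypicProj ρP (lam ^ s) (ρ n v) :=
      LinearMap.congr_fun (isotypicProj_mul_apply ρP (lam ^ s) y) (ρ n v)
    have h2 : ρP y (ρ n v) = lam (c y) • ρ n v := by
      rw [← map_smul, ← hv]
      change ρ y (ρ n v) = ρ n (ρ (n⁻¹ * y * n) v)
      rw [← Module.End.mul_apply, ← Module.End.mul_apply, ← map_mul, ← map_mul]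
      congr 2
      group
    rw [h2, map_smul] at h1
    exact smul_left_injective ℂ hn h1
  have hiter : ∀ (k : ℕ) (y : P), lam (c^[k] y) = lam y ^ s ^ k := by
    intro k
    induction k with
    | zero => intro y; simp
    | succ k ih => intro y; rw [Function.iterate_succ_apply', hc, ih, ← pow_mul, pow_succ]
  have hiterc : ∀ (k : ℕ) (y : P), ((c^[k] y : P) : X) = (n ^ k)⁻¹ * y * n ^ k := by
    intro k
    induction k with
    | zero => intro y; simp
    | succ k ih =>
      intro y
      rw [Function.iterate_succ_apply']
      change n⁻¹ * ((c^[k] y : P) : X) * n = _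
      rw [ih, pow_succ]
      group
  have hnm : n ^ m ∈ (P : Subgroup X) := pow_ordCompl_mem_sylow P n
  -- Conjugating `m` times by `n` is conjugating by `n ^ m ∈ P`, which does not change a linear
  -- character of `P`.
  have hfix : ∀ y, lam y ^ s ^ m = lam y := by
    intro y
    have h1 : c^[m] y = (⟨n ^ m, hnm⟩ : P)⁻¹ * y * ⟨n ^ m, hnm⟩ := Subtype.ext (hiterc m y)
    rw [← hiter, h1, map_mul, map_mul, mul_right_comm, ← map_mul, inv_mul_cancel, map_one, one_mul]
  have hlam : ∀ y, lam y ^ p = 1 := by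
    intro y
    have h1 := hfix y
    rw [hs, ← geom_sum_mul_add, pow_succ] at h1
    set t := ∑ i ∈ Finset.range m, (p * m + 1) ^ i with ht
    have h2 : lam y ^ (t * (p * m)) = 1 := (mul_eq_right₀ (monoidHom_ne_zero lam y)).1 h1
    have htp : t ≡ m [MOD p] := by
      rw [ht]
      have : ∀ i ∈ Finset.range m, (p * m + 1) ^ i ≡ 1 [MOD p] := fun i _ => by
        have h3 : p * m + 1 ≡ 1 [MOD p] := by simp [Nat.ModEq]
        simpa using h3.pow i
      calc ∑ i ∈ Finset.range m, (p * m + 1) ^ i ≡ ∑ i ∈ Finset.range m, 1 [MOD p] :=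
            Nat.ModEq.sum this
        _ = m := by simp
    have htc : (t * m).Coprime (Nat.card P) := by
      rw [P.card_eq_multiplicity]
      refine Nat.Coprime.pow_right _ (Nat.Coprime.mul_left ?_ hpm.symm)
      rw [Nat.Coprime, htp.gcd_eq]
      exact hpm.symm
    have h3 : (lam y ^ p) ^ (t * m) = 1 := by
      rw [← pow_mul, ← h2]
      congr 1
      ring
    have h4 : (lam y ^ p) ^ (Nat.card P) = 1 := by
      rw [← map_pow, ← map_pow, pow_card_eq_one', map_one]
    have h5 := pow_gcd_eq_one.2 ⟨h3, h4⟩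
    rwa [Nat.Coprime.gcd_eq_one htc, pow_one] at h5
  obtain ⟨y, hy, rfl⟩ := hx
  refine apply_eq_one_of_fixed (frattiniOf (P : Subgroup X)) hv0 ?_ ⟨y, hy, rfl⟩
  rintro _ ⟨z, hz, rfl⟩
  have := hv z
  rwa [eq_one_of_mem_frattini hlam hz, one_smul] at this

end NormalSylow

/-! ### The principal block -/

section Block

variable {X V : Type*} [Group X] [Finite X] [AddCommGroup V] [Module ℂ V] [FiniteDimensional ℂ V]

/-- Class functions can be summed over a normal subgroup class by class. -/
lemma exists_sum_eq_sum_conjugates (L : Subgroup X) [hL : L.Normal] [Fintype L] :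
    ∃ T : Finset X, ∀ f : X → ℂ, (∀ g k, f (k * g * k⁻¹) = f g) →
      ∑ x : L, f x = ∑ g ∈ T, (Nat.card (conjugatesOf g) : ℂ) * f g := by
  classical
  let := Fintype.ofFinite X
  let S : Finset X := Finset.univ.filter (· ∈ L)
  let out : X → X := fun x => (ConjClasses.mk x).out
  have hout : ∀ x, IsConj (out x) x := fun x => by
    rw [← ConjClasses.mk_eq_mk_iff_isConj]
    exact Quotient.out_eq (ConjClasses.mk x)
  have houtL : ∀ x ∈ L, out x ∈ L := fun x hx => by
    obtain ⟨k, hk⟩ := isConj_iff.1 (hout x).symm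
    rw [← hk]
    exact hL.conj_mem x hx k
  refine ⟨S.image out, fun f hf => ?_⟩
  have hfc : ∀ x y, IsConj x y → f y = f x := fun x y h => by
    obtain ⟨k, rfl⟩ := isConj_iff.1 h
    exact hf x k
  have h1 : ∑ x : L, f x = ∑ x ∈ S, f x := by
    exact (Finset.sum_subtype S (fun x => by simp [S]) f).symm
  rw [h1, ← Finset.sum_fiberwise_of_maps_to (t := S.image out) (g := out)
    fun x hx => Finset.mem_image_of_mem out hx]
  refine Finset.sum_congr rfl fun g hg => ?_
  obtain ⟨w, hw, rfl⟩ := Finset.mem_image.1 hg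
  have hwL : w ∈ L := by simpa [S] using hw
  have hfib : S.filter (fun x => out x = out w) = (conjugatesOf (out w)).toFinset := by
    ext x
    simp only [S, Finset.mem_filter, Finset.mem_univ, true_and, Set.mem_toFinset]
    constructor
    · rintro ⟨-, h⟩
      rw [← h]
      exact hout x
    · intro h
      have h2 : IsConj (out w) x := h
      refine ⟨?_, ?_⟩
      · obtain ⟨k, rfl⟩ := isConj_iff.1 h2
        exact hL.conj_mem _ (houtL w hwL) k
      · simp only [out]
        congr 1
        exact ConjClasses.mk_eq_mk_iff_isConj.2 (h2.symm.trans (hout w))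
  have hcon : ∀ x ∈ (conjugatesOf (out w)).toFinset, f x = f (out w) := fun x hx => by
    rw [Set.mem_toFinset] at hx
    exact hfc _ _ hx
  rw [hfib, Finset.sum_congr rfl hcon, Finset.sum_const, nsmul_eq_mul]
  simp

variable {p : ℕ} [hp : Fact p.Prime] {M : Ideal AlgInt}

lemma natCast_notMem_of_not_dvd (hM : M ≠ ⊤) (hpM : (p : AlgInt) ∈ M) {n : ℕ} (hn : ¬ p ∣ n) :
    (n : AlgInt) ∉ M := by
  intro h
  refine hM ((Ideal.eq_top_iff_one M).2 ?_)
  have hc : IsCoprime (p : ℤ) n :=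
    Nat.isCoprime_iff_coprime.2 ((Nat.Prime.coprime_iff_not_dvd hp.out).2 hn)
  obtain ⟨a, b, hab⟩ := hc
  have : (1 : AlgInt) = a * p + b * n := by exact_mod_cast hab.symm
  rw [this]
  exact M.add_mem (M.mul_mem_left _ hpM) (M.mul_mem_left _ h)

omit [FiniteDimensional ℂ V] in
/-- The characters of the principal block contain the normal `p'`-subgroups in their kernels. -/
theorem apply_eq_one_of_sameBlock (hM : M ≠ ⊤) (hpM : (p : AlgInt) ∈ M)
    (ρ : Representation ℂ X V) [ρ.IsIrreducible] (hB : SameBlock M ρ.character 1)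
    (L : Subgroup X) [hL : L.Normal] (hpL : ¬ p ∣ Nat.card L) {x : X} (hx : x ∈ L) : ρ x = 1 := by
  have hnt := nontrivial_of_isIrreducible ρ
  let := Fintype.ofFinite L
  by_cases hE : ∃ v, (∑ y : L, ρ y) v ≠ 0
  · obtain ⟨v, hv⟩ := hE
    refine apply_eq_one_of_fixed L hv (fun z hz => ?_) hx
    rw [← Module.End.mul_apply, Finset.mul_sum]
    congr 1
    refine Fintype.sum_equiv (Equiv.mulLeft ⟨z, hz⟩) _ _ fun y => ?_
    rw [← map_mul]
    rfl
  · exfalso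
    -- If the sum over `L` acts as zero, adding the central character values over the classes in `L`
    -- gives `0` for `ρ` and `|L|` for the trivial character, forcing `|L|` into `M`.
    push Not at hE
    have hE0 : ∑ y : L, ρ y = 0 := LinearMap.ext hE
    have hsum : ∑ y : L, ρ.character y = 0 := by
      have := congrArg (LinearMap.trace ℂ V) hE0
      rwa [map_sum, map_zero] at this
    obtain ⟨T, hT⟩ := exists_sum_eq_sum_conjugates L
    have h1 := hT ρ.character fun g k => ρ.char_conj g k
    have h2 := hT 1 fun _ _ => rfl
    rw [hsum] at h1
    choose a haM ha using hB
    have h3 : ((∑ g ∈ T, a g : AlgInt) : ℂ) = -(Nat.card L : ℂ) := by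
      rw [AddSubmonoidClass.coe_finsetSum, Finset.sum_congr rfl fun g _ => ha g,
        Finset.sum_sub_distrib]
      have e1 : ∑ g ∈ T, centralChar ρ.character g = 0 := by
        simp only [centralChar]
        rw [← Finset.sum_div, ← h1, zero_div]
      have e2 : ∑ g ∈ T, centralChar (1 : X → ℂ) g = Nat.card L := by
        simp only [centralChar, Pi.one_apply, div_one]
        simp only [Pi.one_apply] at h2
        rw [← h2]
        simp
      rw [e1, e2, zero_sub]
    have h4 : (∑ g ∈ T, a g : AlgInt) = -((Nat.card L : ℕ) : AlgInt) := Subtype.ext (by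
      rw [h3]
      push_cast
      rfl)
    have h5 : ((Nat.card L : ℕ) : AlgInt) ∈ M := by
      rw [← neg_mem_iff, ← h4]
      exact M.sum_mem fun g _ => haM g
    exact natCast_notMem_of_not_dvd hM hpM hpL h5

/-- A root of unity of `p`-power order is congruent to one modulo `M`. -/
lemma sub_one_mem_of_pow_eq_one [hMp : M.IsPrime] (hpM : (p : AlgInt) ∈ M) {a : ℕ} {μ : AlgInt}
    (hμ : μ ^ p ^ a = 1) : μ - 1 ∈ M := by
  have hchar : CharP (AlgInt ⧸ M) p := by
    have h0 : ((p : ℕ) : AlgInt ⧸ M) = 0 := by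
      rw [← map_natCast (Ideal.Quotient.mk M), Ideal.Quotient.eq_zero_iff_mem]
      exact hpM
    exact (CharP.charP_iff_prime_eq_zero hp.out).2 h0
  rw [← Ideal.Quotient.eq_zero_iff_mem]
  have h : (Ideal.Quotient.mk M (μ - 1)) ^ p ^ a = 0 := by
    rw [map_sub, sub_pow_char_pow, ← map_pow, hμ, map_one, one_pow, sub_self]
  exact pow_eq_zero_iff (pow_pos hp.out.pos a).ne' |>.1 h

/-- The values of a character at `p`-elements are congruent to the degree modulo `M`. -/
lemma exists_mem_eq_character_sub [M.IsPrime] (hpM : (p : AlgInt) ∈ M) (ρ : Representation ℂ X V)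
    {a : ℕ} {z : X} (hz : z ^ p ^ a = 1) :
    ∃ b : AlgInt, b ∈ M ∧ (b : ℂ) = ρ.character z - finrank ℂ V := by
  obtain ⟨S, d, h1, h2⟩ := exists_character_pow_eq_sum ρ z
  have hS : ∀ μ ∈ S, μ ^ p ^ a = 1 := fun μ hμ =>
    pow_eq_one_of_dvd_of_pow_eq_one (orderOf_dvd_of_pow_eq_one hz) (h1 μ hμ)
  have hint : ∀ μ ∈ S, μ ∈ integralClosure ℤ ℂ := fun μ hμ =>
    IsIntegral.of_pow (pow_pos hp.out.pos a) (by rw [hS μ hμ]; exact isIntegral_one)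
  refine ⟨∑ μ : S, (d μ : AlgInt) * (⟨μ, hint μ μ.2⟩ - 1), ?_, ?_⟩
  · refine M.sum_mem fun μ _ => M.mul_mem_left _ (sub_one_mem_of_pow_eq_one (a := a) hpM ?_)
    exact Subtype.ext (by simpa using hS μ μ.2)
  · have e0 := h2 0
    have e1 := h2 1
    rw [pow_zero, Representation.char_one] at e0
    rw [pow_one] at e1
    rw [e0, e1, ← Finset.sum_sub_distrib, ← Finset.sum_coe_sort S,
      AddSubmonoidClass.coe_finsetSum]
    refine Finset.sum_congr rfl fun μ _ => ?_
    push_cast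
    simp
    ring

variable (P : Sylow p X) [hPn : (P : Subgroup X).Normal]

lemma mem_sylow_of_isPGroup {H : Subgroup X} (hH : IsPGroup p H) : H ≤ P := by
  obtain ⟨S, hS⟩ := hH.exists_le_sylow
  have := (Sylow.unique_of_normal P hPn).instSubsingleton
  rwa [Subsingleton.elim S P] at hS

/-- The elements of order prime to `p` centralising a normal Sylow `p`-subgroup lie in `O_{p'}`. -/
lemma mem_primeCore_of_mem_centralizer {m : ℕ} (hm : ¬ p ∣ m) {y : X}
    (hy : y ∈ Subgroup.centralizer (P : Set X)) (hym : y ^ m = 1) : y ∈ primeCore p X := by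
  set C := Subgroup.centralizer (P : Set X) with hC
  have hCn : C.Normal := Subgroup.normal_centralizer
  obtain ⟨S⟩ : Nonempty (Sylow p C) := inferInstance
  have hcen : Subgroup.normalizer (S : Set C) ≤ Subgroup.centralizer (S : Set C) := by
    intro g _ s hs
    -- A Sylow `p`-subgroup of `C_X(P)` lies in `P`, so it is central there. Burnside's transfer
    -- theorem then yields a normal `p`-complement, consisting of all `p'`-elements and so normal in
    -- `X`.
    have h1 : ((S : Subgroup C).map C.subtype) ≤ P :=
      mem_sylow_of_isPGroup P (S.isPGroup'.map _)
    have h2 : (s : X) ∈ (P : Subgroup X) := h1 ⟨s, hs, rfl⟩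
    exact Subtype.ext (Subgroup.mem_centralizer_iff.1 g.2 s h2)
  let φ := MonoidHom.transferSylow S hcen
  have hker : ∀ c : C, c ∈ φ.ker ↔ ¬ p ∣ orderOf c := by
    intro c
    constructor
    · intro hc hd
      have h1 : orderOf c ∣ Nat.card φ.ker := by
        have := orderOf_dvd_natCard (⟨c, hc⟩ : φ.ker)
        rwa [Subgroup.orderOf_mk] at this
      exact MonoidHom.not_dvd_card_ker_transferSylow S hcen (hd.trans h1)
    · intro hc
      by_contra h1
      exact hc ((S.isPGroup'.dvd_orderOf (g := φ c) h1).trans (orderOf_map_dvd φ c))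
  have hYn : (φ.ker.map C.subtype).Normal := by
    refine ⟨?_⟩
    rintro _ ⟨c, hc, rfl⟩ n
    refine ⟨⟨n * c * n⁻¹, hCn.conj_mem c c.2 n⟩, (hker _).2 ?_, rfl⟩
    have h1 := (hker c).1 hc
    rw [← Subgroup.orderOf_coe] at h1 ⊢
    have h2 : orderOf (n * (c : X) * n⁻¹) = orderOf (c : X) :=
      MulEquiv.orderOf_eq (MulAut.conj n) (c : X)
    rwa [h2]
  have hYc : ¬ p ∣ Nat.card (φ.ker.map C.subtype) := by
    rw [Nat.card_congr (φ.ker.equivMapOfInjective C.subtype C.subtype_injective).toEquiv.symm]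
    exact MonoidHom.not_dvd_card_ker_transferSylow S hcen
  have hyker : y ∈ φ.ker.map C.subtype := by
    refine ⟨⟨y, hy⟩, (hker _).2 fun hd => hm (hd.trans ?_), rfl⟩
    rw [Subgroup.orderOf_mk]
    exact orderOf_dvd_of_pow_eq_one hym
  exact (le_sSup (show _ ∈ {L : Subgroup X | L.Normal ∧ ¬ p ∣ Nat.card L} from ⟨hYn, hYc⟩) :
    φ.ker.map C.subtype ≤ primeCore p X) hyker

/-- The irreducible characters of degree prime to `p` with `O_{p'}` in the kernel lie in the
principal block. -/
theorem sameBlock_one_of_primeCore [hMp : M.IsPrime] (hpM : (p : AlgInt) ∈ M)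
    (P : Sylow p X) [hPn : (P : Subgroup X).Normal]
    (ρ : Representation ℂ X V) [ρ.IsIrreducible] (hdeg : ¬ p ∣ finrank ℂ V)
    (hker : ∀ x ∈ primeCore p X, ρ x = 1) : SameBlock M ρ.character 1 := by
  have hnt := nontrivial_of_isIrreducible ρ
  have hd0 : (finrank ℂ V : ℂ) ≠ 0 := Nat.cast_ne_zero.2 finrank_pos.ne'
  intro g
  have hclint : centralChar (1 : X → ℂ) g = ((Nat.card (conjugatesOf g) : ℕ) : AlgInt) := by
    simp [centralChar]
  have hint : centralChar ρ.character g ∈ integralClosure ℤ ℂ := isIntegral_centralChar ρ g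
  refine ⟨⟨_, hint⟩ - ((Nat.card (conjugatesOf g) : ℕ) : AlgInt), ?_, by rw [hclint]; rfl⟩
  refine (hMp.mem_or_mem (x := (finrank ℂ V : AlgInt)) ?_).resolve_left
    (natCast_notMem_of_not_dvd hMp.ne_top hpM hdeg)
  have hcint : ρ.character g ∈ integralClosure ℤ ℂ := isIntegral_character ρ g
  -- The degree is a unit modulo `M`, so the congruence reduces to `|cl(g)| (χ(g) - χ(1)) ∈ M`.
  have hmul : (finrank ℂ V : AlgInt) * (⟨_, hint⟩ - ((Nat.card (conjugatesOf g) : ℕ) : AlgInt)) =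
      ((Nat.card (conjugatesOf g) : ℕ) : AlgInt) * (⟨_, hcint⟩ - (finrank ℂ V : AlgInt)) := by
    apply Subtype.ext
    push_cast
    rw [centralChar, Representation.char_one]
    field_simp
  rw [hmul]
  by_cases hcl : p ∣ Nat.card (conjugatesOf g)
  · obtain ⟨k, hk⟩ := hcl
    rw [hk, Nat.cast_mul]
    exact M.mul_mem_right _ (M.mul_mem_right _ hpM)
  refine M.mul_mem_left _ ?_
  -- `P` acts by conjugation on a class of size prime to `p`, so it fixes some conjugate of `g`;
  -- normality of `P` transfers this to `g`. The `p'`-part of `g` then lies in `O_{p'}(X)`, and only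
  -- its `p`-part affects the character.
  have hcent : g ∈ Subgroup.centralizer (P : Set X) := by
    have hcl' : ¬ p ∣ Nat.card (MulAction.orbit (ConjAct X) g) := by
      have : MulAction.orbit (ConjAct X) g = conjugatesOf g := by
        ext x
        rw [ConjAct.mem_orbit_conjAct, isConj_comm]
        rfl
      rwa [this]
    let act : MulAction P (MulAction.orbit (ConjAct X) g) :=
      MulAction.compHom _ ((ConjAct.toConjAct : X ≃* ConjAct X).toMonoidHom.comp
        (P : Subgroup X).subtype)
    obtain ⟨⟨x, hx⟩, hfix⟩ := P.isPGroup'.nonempty_fixed_point_of_prime_not_dvd_card _ hcl'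
    obtain ⟨k, hk⟩ := isConj_iff.1 (ConjAct.mem_orbit_conjAct.1 hx)
    rw [Subgroup.mem_centralizer_iff]
    intro z hz
    have hy : k⁻¹ * z * k ∈ (P : Subgroup X) := by
      have := hPn.conj_mem z hz k⁻¹
      rwa [inv_inv] at this
    have h1 : (k⁻¹ * z * k) * x * (k⁻¹ * z * k)⁻¹ = x := congrArg Subtype.val (hfix ⟨_, hy⟩)
    rw [← hk]
    calc z * (k * x * k⁻¹) = k * ((k⁻¹ * z * k) * x * (k⁻¹ * z * k)⁻¹) * k⁻¹ * z := by group
      _ = k * x * k⁻¹ * z := by rw [h1]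
  set m := ordCompl[p] (Nat.card X) with hm
  have hX : Nat.card X ≠ 0 := Nat.card_pos.ne'
  have hpm : ¬ p ∣ m := Nat.not_dvd_ordCompl hp.out hX
  set a := (Nat.card X).factorization p with ha
  have ham : p ^ a * m = Nat.card X := Nat.ordProj_mul_ordCompl_eq_self _ p
  have hcop : (p ^ a).Coprime m := ((Nat.Prime.coprime_iff_not_dvd hp.out).2 hpm).pow_left a
  obtain ⟨u, hu0, hu1⟩ := Nat.chineseRemainder hcop 0 1
  have hgX : g ^ (p ^ a * m) = 1 := by rw [ham, pow_card_eq_one']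
  have hgp : (g ^ p ^ a) ^ m = 1 := by rw [← pow_mul, hgX]
  have hgm : (g ^ m) ^ p ^ a = 1 := by rw [← pow_mul, mul_comm, hgX]
  have hy : g ^ u ∈ primeCore p X := by
    refine mem_primeCore_of_mem_centralizer P hpm (Subgroup.pow_mem _ hcent u) ?_
    obtain ⟨d, hd⟩ := (Nat.modEq_zero_iff_dvd).1 hu0
    rw [hd, pow_mul, pow_right_comm, hgp, one_pow]
  have hz : (g * (g ^ u)⁻¹) ^ p ^ a = 1 := by
    have hc : Commute g (g ^ u)⁻¹ := ((Commute.refl g).pow_right u).inv_right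
    rw [hc.mul_pow, inv_pow, ← pow_mul, mul_comm u, pow_mul, pow_eq_pow_of_modEq hu1 hgp, pow_one,
      mul_inv_cancel]
  obtain ⟨b, hbM, hb⟩ := exists_mem_eq_character_sub hpM ρ hz
  rw [character_mul_right_of_apply_eq_one (hker _ (Subgroup.inv_mem _ hy))] at hb
  convert hbM using 1
  apply Subtype.ext
  rw [hb]
  push_cast
  rfl

end Block

/-! ### Groups with a normal Sylow subgroup -/

section NormalSylow

variable {X : Type*} [Group X] [Finite X] {p : ℕ} [hp : Fact p.Prime] {M : Ideal AlgInt}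

lemma coprime_of_coprime_of_modEq_one {p N s : ℕ} (hs : s.Coprime p)
    (hs1 : s ≡ 1 [MOD ordCompl[p] N]) : s.Coprime N := by
  have h : s.Coprime (ordCompl[p] N) := by
    rw [Nat.Coprime, hs1.gcd_eq, Nat.gcd_one_left]
  rw [← Nat.ordProj_mul_ordCompl_eq_self N p]
  exact (hs.pow_right _).mul_right h

/-- The characters of `Irr_{p'}(B_0(X))` have `O_{p'}(X)` in their kernel. -/
lemma apply_eq_one_of_mem_primeCore (hM : M ≠ ⊤) (hpM : (p : AlgInt) ∈ M) {V : Type*}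
    [AddCommGroup V] [Module ℂ V] [FiniteDimensional ℂ V] (ρ : Representation ℂ X V)
    [ρ.IsIrreducible] (hB : SameBlock M ρ.character 1) {x : X} (hx : x ∈ primeCore p X) :
    ρ x = 1 := by
  have h : primeCore p X ≤ MonoidHom.ker ρ := sSup_le fun L hL y hy => by
    have := hL.1
    exact apply_eq_one_of_sameBlock hM hpM ρ hB L hL.2 hy
  exact h hx

variable (P : Sylow p X) [hPn : (P : Subgroup X).Normal]

/-- A Sylow subgroup of a quotient consists of the images of the elements of the Sylow subgroup. -/
lemma coe_sylow_quotient (κ : Subgroup X) [κ.Normal] (Q : Sylow p (X ⧸ κ)) :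
    (Q : Subgroup (X ⧸ κ)) = (P : Subgroup X).map (QuotientGroup.mk' κ) := by
  have hs : Function.Surjective (QuotientGroup.mk' κ) := QuotientGroup.mk'_surjective _
  have h : (P.mapSurjective hs : Subgroup (X ⧸ κ)).Normal := by
    rw [Sylow.coe_mapSurjective]
    exact hPn.map _ hs
  have := (Sylow.unique_of_normal _ h).instSubsingleton
  rw [Subsingleton.elim Q (P.mapSurjective hs), Sylow.coe_mapSurjective]

lemma mem_sylow_quotient_iff (κ : Subgroup X) [κ.Normal] (Q : Sylow p (X ⧸ κ)) (q : X ⧸ κ) :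
    q ∈ Q ↔ ∃ x ∈ P, QuotientGroup.mk' κ x = q := by
  change q ∈ (Q : Subgroup (X ⧸ κ)) ↔ _
  rw [coe_sylow_quotient P]
  rfl

/-- The quotient `X / O_{p'}(X) Φ(P)`. -/
abbrev FrattiniQuotient : Type _ :=
  X ⧸ (primeCore p X ⊔ frattiniOf (P : Subgroup X))

variable {P}

omit [Finite X] hp in
lemma mk_eq_one_of_mem_frattini {x : P} (hx : x ∈ frattini P) :
    QuotientGroup.mk' (primeCore p X ⊔ frattiniOf (P : Subgroup X)) (x : X) = 1 :=
  (QuotientGroup.eq_one_iff _).2 (Subgroup.mem_sup_right ⟨x, hx, rfl⟩)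

variable (Q : Sylow p (FrattiniQuotient P))

lemma mul_comm_of_mem_sylow_frattiniQuotient {a b : FrattiniQuotient P} (ha : a ∈ Q)
    (hb : b ∈ Q) : a * b = b * a := by
  obtain ⟨x, hx, rfl⟩ := (mem_sylow_quotient_iff P _ Q a).1 ha
  obtain ⟨y, hy, rfl⟩ := (mem_sylow_quotient_iff P _ Q b).1 hb
  have h := mk_eq_one_of_mem_frattini (commutator_mem_frattini P.isPGroup' ⟨x, hx⟩ ⟨y, hy⟩)
  exact mul_inv_eq_one.1 h

lemma pow_eq_one_of_mem_sylow_frattiniQuotient {q : FrattiniQuotient P} (hq : q ∈ Q) :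
    q ^ p = 1 := by
  obtain ⟨x, hx, rfl⟩ := (mem_sylow_quotient_iff P _ Q q).1 hq
  exact mk_eq_one_of_mem_frattini (pow_mem_frattini P.isPGroup' ⟨x, hx⟩)

lemma pow_ordCompl_mem_sylow_frattiniQuotient (g : FrattiniQuotient P) :
    g ^ ordCompl[p] (Nat.card X) ∈ Q := by
  obtain ⟨x, rfl⟩ := QuotientGroup.mk'_surjective _ g
  exact (mem_sylow_quotient_iff P _ Q _).2 ⟨_, pow_ordCompl_mem_sylow P x, map_pow _ _ _⟩

variable (P)

/-- The criterion for all almost `p`-rational characters in `Irr_{p'}(B_0(X))` to be `p`-rational,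
in terms of the power maps on the conjugacy classes of `X / O_{p'}(X) Φ(P)`. -/
theorem noLevelOneInPrincipalBlock_iff_isConj_pow (hM : M.IsMaximal) (hpM : (p : AlgInt) ∈ M) :
    NoLevelOneInPrincipalBlock p M X ↔
      ∀ s : ℕ, s.Coprime p → s ≡ 1 [MOD ordCompl[p] (Nat.card X)] →
        ∀ g : FrattiniQuotient P, IsConj g (g ^ s) := by
  have hMp : M.IsPrime := hM.isPrime
  set κ := primeCore p X ⊔ frattiniOf (P : Subgroup X) with hκ
  have hs : Function.Surjective (QuotientGroup.mk' κ) := QuotientGroup.mk'_surjective _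
  obtain ⟨Q⟩ : Nonempty (Sylow p (FrattiniQuotient P)) := inferInstance
  have hQn : (Q : Subgroup (FrattiniQuotient P)).Normal := by
    rw [coe_sylow_quotient P]
    exact hPn.map _ hs
  constructor
  · intro h s hsp hs1 g
    refine isConj_of_forall_character_eq fun χ hχ => ?_
    obtain ⟨n, ρ, hρ, rfl⟩ := hχ
    have hρ' := isIrreducible_comp (ρ := ρ) (QuotientGroup.mk' κ) hs
    let σ : Representation ℂ X (Fin n → ℂ) := ρ.comp (QuotientGroup.mk' κ)
    have hσ : σ.IsIrreducible := hρ'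
    have hdeg : ¬ p ∣ finrank ℂ (Fin n → ℂ) := by
      -- Schur–Zassenhaus supplies the complement; the degree divides its order, the index of `Q`.
      obtain ⟨H, hH⟩ := Subgroup.exists_right_complement'_of_coprime
        (N := (Q : Subgroup (X ⧸ κ))) Q.card_coprime_index
      have : IsMulCommutative (Q : Subgroup (X ⧸ κ)) :=
        ⟨⟨fun a b => Subtype.ext (mul_comm_of_mem_sylow_frattiniQuotient Q a.2 b.2)⟩⟩
      intro hd
      have h1 := hd.trans (finrank_dvd_card_of_isComplement' ρ hH)
      rw [← hH.symm.index_eq_card] at h1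
      exact Q.not_dvd_index h1
    have hB : SameBlock M σ.character 1 :=
      sameBlock_one_of_primeCore hpM P σ hdeg fun x hx => by
        have h1 : QuotientGroup.mk' κ x = 1 :=
          (QuotientGroup.eq_one_iff x).2 (Subgroup.mem_sup_left hx)
        change ρ (QuotientGroup.mk' κ x) = 1
        rw [h1, map_one]
    have halm : IsAlmostPRational p σ.character :=
      isAlmostPRational_of_character_pow σ p fun t _ ht x => by
        change LinearMap.trace _ _ (ρ (QuotientGroup.mk' κ (x ^ t))) =
          LinearMap.trace _ _ (ρ (QuotientGroup.mk' κ x))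
        have h1 : QuotientGroup.mk' κ x ^ (p * ordCompl[p] (Nat.card X)) = 1 := by
          rw [mul_comm, pow_mul]
          exact pow_eq_one_of_mem_sylow_frattiniQuotient Q
            (pow_ordCompl_mem_sylow_frattiniQuotient Q _)
        rw [map_pow, pow_eq_pow_of_modEq ht h1, pow_one]
    have hrat := h σ.character ⟨character_mem_Irr, _, σ.char_one, hdeg⟩
      ⟨character_mem_Irr, hB⟩ halm
    obtain ⟨x, rfl⟩ := hs g
    have := (isPRational_character_iff σ p).1 hrat s (coprime_of_coprime_of_modEq_one hsp hs1) hs1 x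
    rw [← map_pow]
    exact this.symm
  · rintro h χ ⟨⟨n, ρ, hρ, rfl⟩, d, hd1, hd⟩ ⟨-, hB⟩ halm
    have hdeg : ¬ p ∣ finrank ℂ (Fin n → ℂ) := by
      rwa [Nat.cast_injective (R := ℂ) (ρ.char_one.symm.trans hd1)]
    have hker : κ ≤ MonoidHom.ker ρ :=
      sup_le (fun x hx => apply_eq_one_of_mem_primeCore hM.ne_top hpM ρ hB hx)
        fun x hx => apply_eq_one_of_mem_frattiniOf P ρ hdeg halm hx
    refine (isPRational_character_iff ρ p).2 fun s hsX hs1 g => ?_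
    -- Being prime to `|X|` gives `s` prime to `p` only when `p` divides `|X|`; otherwise `s ≡ 1`
    -- modulo `|X|` and the power map is the identity.
    by_cases hpX : p ∣ Nat.card X
    · obtain ⟨c, hc⟩ := isConj_iff.1 (h s (hsX.coprime_dvd_right hpX) hs1 (QuotientGroup.mk' κ g))
      obtain ⟨k, rfl⟩ := hs c
      rw [← map_inv, ← map_mul, ← map_mul, ← map_pow] at hc
      have hl : (k * g * k⁻¹)⁻¹ * g ^ s ∈ κ := QuotientGroup.eq.1 hc
      rw [← ρ.char_conj g k, ← character_mul_right_of_apply_eq_one (hker hl) (k * g * k⁻¹),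
        mul_inv_cancel_left]
    · rw [Nat.factorization_eq_zero_of_not_dvd hpX, pow_zero, Nat.div_one] at hs1
      rw [pow_eq_pow_of_modEq hs1 pow_card_eq_one', pow_one]

/-- The criterion in terms of the normalisers of the subgroups of order `p`. -/
theorem noLevelOneInPrincipalBlock_iff_forall_mem_sylow (hM : M.IsMaximal)
    (hpM : (p : AlgInt) ∈ M) [hQ : (Q : Subgroup (FrattiniQuotient P)).Normal] :
    NoLevelOneInPrincipalBlock p M X ↔
      ∀ y ∈ (Q : Subgroup (FrattiniQuotient P)), y ≠ 1 →
        FullAutomizer y ∧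
        TrivialOnCentralizerClasses (Q : Subgroup (FrattiniQuotient P)) y :=
  (noLevelOneInPrincipalBlock_iff_isConj_pow P hM hpM).trans <|
    forall_isConj_pow_iff (Q : Subgroup (FrattiniQuotient P))
      (fun _ ha _ hb => mul_comm_of_mem_sylow_frattiniQuotient Q ha hb)
      (fun _ hq => pow_eq_one_of_mem_sylow_frattiniQuotient Q hq)
      (Nat.not_dvd_ordCompl hp.out Nat.card_pos.ne')
      (pow_ordCompl_mem_sylow_frattiniQuotient Q)

end NormalSylow

end BlockTheory

theorem corollary5p8 {G : Type*} [Group G] [Finite G] (p : ℕ) [Fact p.Prime]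
    (M : Ideal AlgInt) (hM : M.IsMaximal) (hpM : (p : AlgInt) ∈ M)
    (P : Sylow p G) (hG : NavarroBijection p M P)
    (Q : Sylow p (LocalQuotient P)) :
    NoLevelOneInPrincipalBlock p M G ↔
      ∀ y ∈ (Q : Subgroup (LocalQuotient P)), y ≠ 1 →
        FullAutomizer y ∧
        TrivialOnCentralizerClasses (Q : Subgroup (LocalQuotient P)) y := by
  let P₁ : Sylow p (normalizerSylow P) := P.subtype Subgroup.le_normalizer
  have h₁ : (P₁ : Subgroup (normalizerSylow P)).Normal := by
    change ((P : Subgroup G).subgroupOf (normalizerSylow P)).Normal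
    infer_instance
  have hQ : (Q : Subgroup (LocalQuotient P)).Normal := inferInstance
  -- The local quotient of `P` is the Frattini quotient of `P₁`, so only the transfer of condition
  -- (i) between `G` and `N_G(P)` remains.
  refine Iff.trans ?_ (noLevelOneInPrincipalBlock_iff_forall_mem_sylow P₁ Q hM hpM (hQ := hQ))
  obtain ⟨e, he⟩ := hG
  have hlev : ∀ χ : IrrPrime p G,
      pLevel p (χ : G → ℂ) = pLevel p (e χ : normalizerSylow P → ℂ) := fun χ =>
    Nat.pow_right_injective (Fact.out : p.Prime).two_le (he χ).1
  constructor
  · intro h ψ hψ hB halm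
    obtain ⟨χ, hχ⟩ := e.surjective ⟨ψ, hψ⟩
    obtain rfl : (e χ : normalizerSylow P → ℂ) = ψ := congrArg Subtype.val hχ
    exact (hlev χ).symm.trans (h χ χ.2 ((he χ).2.2 hB) ((hlev χ).le.trans halm))
  · intro h χ hχ hB halm
    exact (hlev ⟨χ, hχ⟩).trans (h _ (e ⟨χ, hχ⟩).2 ((he ⟨χ, hχ⟩).2.1 hB)
      ((hlev ⟨χ, hχ⟩).ge.trans halm))
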